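/- Let $A\in\mathbb R^{N\times N}$ be stable (all eigenvalues in the open unit disc) and diagonalizable, $A=V\Lambda U'$ with $\Lambda$ diagonal and $U'V=VU'=I$ ($'$ is the transpose), and split the modes into four groups $co,\ c\bar o,\ \bar c o,\ \bar c\bar o$, the group $co$ having $l$ elements. For $\varepsilon\in\mathbb R$ let $B=B_\varepsilon\in\mathbb R^{N\times p}$, $C=C_\varepsilon\in\mathbb R^{q\times N}$ be such that $$U_{\bar c o}'B=\varepsilon C_1,\quad U_{\bar c\bar o}'B=\varepsilon C_2,\quad CV_{c\bar o}=\varepsilon C_3,\quad CV_{\bar c\bar o}=\varepsilon C_4$$ with constant matrices $C_1,\dots,C_4$, while $U_{co}'B,\ U_{c\bar o}'B,\ CV_{co},\ CV_{\bar c o}$ do not depend on $\varepsilon$. Assume that the $co$ modes are controllable and observable: no left eigenvector $x\ne0$ of $A$ in the span of the columns of $U_{co}$ has $x'B=0$, and no right eigenvector $x\neq 0$ of $A$ in the span of the columns of $V_{co}$ has $Cx=0$. Let $u_k,v_k$ be Gaussian white noises (all components at all times independent, centered, with one common positive variance within each noise). Run $x_k=Ax_{k-1}+Bu_k$, $x_0=0$,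 and $z_k=A'z_{k-1}+C'v_k$, $z_0=0$; let $X_r$ and $Z_r$ be the matrices whose columns are the states at times $1\le t_1<\dots<t_m$ and $1\le \hat t_1<\dots<\hat t_n$, where $m,n\ge l$. Let $\sigma_1\ge\sigma_2\ge\cdots$ be the singular values of $H_\varepsilon=Z_r'X_r$ (continued by $0$). Whenever $\sigma_l>0$, let $\Sigma_r=\mathrm{diag}(\sigma_1,\dots,\sigma_l)$, let $L_r,R_r$ hold the first $l$ left and right singular vectors of a singular value decomposition of $H_\varepsilon$, $T_r=X_rR_r\Sigma_r^{-1/2}$, $S_r=\Sigma_r^{-1/2}L_r'Z_r'$, $S_rAT_r=P_r\Lambda_rP_r^{-1}$ with $\Lambda_r$ diagonal, $\Phi_r=P_r^{-1}S_r$, $\Psi_r=T_rP_r$. The RPOD$^*$ reduced-order model is $A_r=\Phi_rA\Psi_r$, $B_r=\Phi_rB$, $C_r=C\Psi_r$. Write $H_\varepsilon=H_0+\varepsilon E_1+O(\varepsilon^2)$, and let the columns of $L_o$ and $R_o$ be bases of $\ker H_0'$ and $\ker H_0$. Then, almost surely, there are $K$ and $\varepsilon_0>0$ (depending on everything above, including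 the noise realization, but not on $\varepsilon$, on $i$, or on the choices made in the two decompositions) such that for all $|\varepsilon|<\varepsilon_0$: 1. $\sigma_l>0$ and $\sigma_{l+1}\le K|\varepsilon|$; 2. $\|C_rA_r^iB_r-CA^iB\|_2\le K|\varepsilon|$ for all $i\ge1$ and every reduced-order model as above; 3. if $L_o'E_1R_o\neq0$ (that is, if the first-order coefficient of $\sigma_{l+1}$ in $\varepsilon$ does not vanish), then also $|\varepsilon|\le K\sigma_{l+1}$ and $\|C_rA_r^iB_r-CA^iB\|_2\le K\sigma_{l+1}$ for all $i\ge1$ and every such model. -/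

import Mathlib

open MeasureTheory ProbabilityTheory
open scoped Matrix Matrix.Norms.L2Operator NNReal

noncomputable section

namespace RPOD

/-- A real matrix viewed as a complex matrix. -/
abbrev toC {m n : Type*} (M : Matrix m n ℝ) : Matrix m n ℂ := M.map Complex.ofReal

/-- The state at time `k` of `x_k = A x_{k-1} + B u_k`, started at `x_0 = 0`. -/
def state {ι κ : Type*} [Fintype ι] [Fintype κ] (A : Matrix ι ι ℝ) (B : Matrix ι κ ℝ)
    (u : ℕ → κ → ℝ) : ℕ → ι → ℝ
  | 0 => 0
  | k + 1 => A *ᵥ state A B u k + B *ᵥ u (k + 1)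

/-- The snapshot ensemble: column `k` is the state at time `t k`. -/
def snapshots {ι κ : Type*} [Fintype ι] [Fintype κ] {m : ℕ} (A : Matrix ι ι ℝ) (B : Matrix ι κ ℝ)
    (u : ℕ → κ → ℝ) (t : Fin m → ℕ) : Matrix ι (Fin m) ℝ :=
  Matrix.of fun i k => state A B u (t k) i

/-- The primal snapshot ensemble `X_r`, from `x_k = A x_{k-1} + B u_k`. -/
def primalSnapshots {N p m : ℕ} (A : Matrix (Fin N) (Fin N) ℝ) (B : Matrix (Fin N) (Fin p) ℝ)
    (u : ℕ → Fin p → ℝ) (t : Fin m → ℕ) : Matrix (Fin N) (Fin m) ℝ :=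
  snapshots A B u t

/-- The adjoint snapshot ensemble `Z_r`, from `z_k = A' z_{k-1} + C' v_k`. -/
def adjointSnapshots {N q n : ℕ} (A : Matrix (Fin N) (Fin N) ℝ) (C : Matrix (Fin q) (Fin N) ℝ)
    (v : ℕ → Fin q → ℝ) (s : Fin n → ℕ) : Matrix (Fin N) (Fin n) ℝ :=
  snapshots Aᵀ Cᵀ v s

/-- The matrix `Z_r' X_r`. -/
def hankel {N p q m n : ℕ} (A : Matrix (Fin N) (Fin N) ℝ) (B : Matrix (Fin N) (Fin p) ℝ)
    (C : Matrix (Fin q) (Fin N) ℝ) (u : ℕ → Fin p → ℝ) (v : ℕ → Fin q → ℝ)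
    (t : Fin m → ℕ) (s : Fin n → ℕ) : Matrix (Fin n) (Fin m) ℝ :=
  (adjointSnapshots A C v s)ᵀ * primalSnapshots A B u t

/-- The singular values of a real matrix in nonincreasing order, continued by `0`.
The numbering starts at `0`: `singularValue H l` is the `(l+1)`-th singular value. -/
def singularValue {n m : ℕ} (H : Matrix (Fin n) (Fin m) ℝ) (k : ℕ) : ℝ :=
  (Matrix.toEuclideanLin H).singularValues k

/-- `H = L Σ R'` is a (full) singular value decomposition of `H`, with the singular values
in nonincreasing order. -/
structure IsSVD {n m : ℕ} (H : Matrix (Fin n) (Fin m) ℝ) (L : Matrix (Fin n) (Fin n) ℝ)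
    (R : Matrix (Fin m) (Fin m) ℝ) : Prop where
  left_mem : L ∈ Matrix.orthogonalGroup (Fin n) ℝ
  right_mem : R ∈ Matrix.orthogonalGroup (Fin m) ℝ
  eq : H = L * (Matrix.of fun (i : Fin n) (j : Fin m) =>
    if (i : ℕ) = (j : ℕ) then singularValue H i else 0) * Rᵀ

/-- The first `l` columns of a matrix. -/
def firstCols {N k l : ℕ} (h : l ≤ k) (M : Matrix (Fin N) (Fin k) ℝ) : Matrix (Fin N) (Fin l) ℝ :=
  M.submatrix id (Fin.castLE h)

/-- `Σ_r^{-1/2}`, where `Σ_r` holds the first `l` singular values of `H`. -/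
def invSqrtSigma {n m : ℕ} (l : ℕ) (H : Matrix (Fin n) (Fin m) ℝ) : Matrix (Fin l) (Fin l) ℝ :=
  Matrix.diagonal fun i => (Real.sqrt (singularValue H i))⁻¹

/-- `(Ar, Br, Cr)` is a reduced-order model of order `l` of `(A, B, C)` produced by the RPOD*
algorithm from the ensembles `X` and `Z`, truncating at the `l`-th singular value, for some choice
of the singular value decomposition of `Z' X` and of the eigendecomposition of `S_r A T_r`. -/
def IsROM {N p q m n l : ℕ} (hm : l ≤ m) (hn : l ≤ n)
    (A : Matrix (Fin N) (Fin N) ℝ) (B : Matrix (Fin N) (Fin p) ℝ) (C : Matrix (Fin q) (Fin N) ℝ)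
    (X : Matrix (Fin N) (Fin m) ℝ) (Z : Matrix (Fin N) (Fin n) ℝ)
    (Ar : Matrix (Fin l) (Fin l) ℂ) (Br : Matrix (Fin l) (Fin p) ℂ)
    (Cr : Matrix (Fin q) (Fin l) ℂ) : Prop :=
  ∃ (L : Matrix (Fin n) (Fin n) ℝ) (R : Matrix (Fin m) (Fin m) ℝ)
    (T : Matrix (Fin N) (Fin l) ℝ) (S : Matrix (Fin l) (Fin N) ℝ)
    (P : Matrix (Fin l) (Fin l) ℂ) (Λr : Fin l → ℂ)
    (Φ : Matrix (Fin l) (Fin N) ℂ) (Ψ : Matrix (Fin N) (Fin l) ℂ),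
    IsSVD (Zᵀ * X) L R ∧
    (∀ i, i < l → 0 < singularValue (Zᵀ * X) i) ∧
    T = X * firstCols hm R * invSqrtSigma l (Zᵀ * X) ∧
    S = invSqrtSigma l (Zᵀ * X) * (firstCols hn L)ᵀ * Zᵀ ∧
    IsUnit P.det ∧
    toC (S * A * T) = P * Matrix.diagonal Λr * P⁻¹ ∧
    Φ = P⁻¹ * toC S ∧
    Ψ = toC T * P ∧
    Ar = Φ * toC A * Ψ ∧
    Br = Φ * toC B ∧
    Cr = toC C * Ψ

/-- Stability in discrete time: every eigenvalue lies in the open unit disc. -/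
def IsStable {N : ℕ} (A : Matrix (Fin N) (Fin N) ℝ) : Prop :=
  ∀ μ ∈ spectrum ℂ (toC A), ‖μ‖ < 1

/-- The index set of the modes in four groups: `l` controllable and observable ones, then the
controllable but unobservable, the uncontrollable but observable, and the uncontrollable and
unobservable ones. -/
abbrev ModeIndex (l a b d : ℕ) : Type := Fin l ⊕ Fin a ⊕ Fin b ⊕ Fin d

/-- `A = V Λ U'` with `Λ` diagonal, `U' V = 1` and `V U' = 1`; the columns of `V` and `U` are right
and left eigenvectors. Here `'` is the transpose without conjugation. -/
structure IsModalDecomposition {N : ℕ} {ι : Type*} [Fintype ι] [DecidableEq ι]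
    (A : Matrix (Fin N) (Fin N) ℝ) (V : Matrix (Fin N) ι ℂ) (Λ : ι → ℂ)
    (U : Matrix (Fin N) ι ℂ) : Prop where
  left_inv : Uᵀ * V = 1
  right_inv : V * Uᵀ = 1
  eq : toC A = V * Matrix.diagonal Λ * Uᵀ

section Blocks
variable {N l a b d : ℕ}

/-- The columns of the controllable and observable modes. -/
def blockCO (W : Matrix (Fin N) (ModeIndex l a b d) ℂ) : Matrix (Fin N) (Fin l) ℂ :=
  W.submatrix id Sum.inl

/-- The columns of the controllable but unobservable modes. -/
def blockCU (W : Matrix (Fin N) (ModeIndex l a b d) ℂ) : Matrix (Fin N) (Fin a) ℂ :=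
  W.submatrix id fun i => Sum.inr (Sum.inl i)

/-- The columns of the uncontrollable but observable modes. -/
def blockUO (W : Matrix (Fin N) (ModeIndex l a b d) ℂ) : Matrix (Fin N) (Fin b) ℂ :=
  W.submatrix id fun i => Sum.inr (Sum.inr (Sum.inl i))

/-- The columns of the uncontrollable and unobservable modes. -/
def blockUU (W : Matrix (Fin N) (ModeIndex l a b d) ℂ) : Matrix (Fin N) (Fin d) ℂ :=
  W.submatrix id fun i => Sum.inr (Sum.inr (Sum.inr i))

end Blocks

/-- The input matrices `B ε` and output matrices `C ε` are weakly coupled to the uncontrollable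
and the unobservable modes: the corresponding blocks of `U' B ε` and `C ε V` are `ε` times
constant matrices, and the other blocks do not depend on `ε`. -/
structure IsWeaklyCoupled {N p q l a b d : ℕ} (V U : Matrix (Fin N) (ModeIndex l a b d) ℂ)
    (B : ℝ → Matrix (Fin N) (Fin p) ℝ) (C : ℝ → Matrix (Fin q) (Fin N) ℝ) : Prop where
  input_co : ∃ M : Matrix (Fin l) (Fin p) ℂ, ∀ ε, (blockCO U)ᵀ * toC (B ε) = M
  input_cu : ∃ M : Matrix (Fin a) (Fin p) ℂ, ∀ ε, (blockCU U)ᵀ * toC (B ε) = M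
  input_uo : ∃ C₁ : Matrix (Fin b) (Fin p) ℂ, ∀ ε, (blockUO U)ᵀ * toC (B ε) = (ε : ℂ) • C₁
  input_uu : ∃ C₂ : Matrix (Fin d) (Fin p) ℂ, ∀ ε, (blockUU U)ᵀ * toC (B ε) = (ε : ℂ) • C₂
  output_co : ∃ M : Matrix (Fin q) (Fin l) ℂ, ∀ ε, toC (C ε) * blockCO V = M
  output_uo : ∃ M : Matrix (Fin q) (Fin b) ℂ, ∀ ε, toC (C ε) * blockUO V = M
  output_cu : ∃ C₃ : Matrix (Fin q) (Fin a) ℂ, ∀ ε, toC (C ε) * blockCU V = (ε : ℂ) • C₃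
  output_uu : ∃ C₄ : Matrix (Fin q) (Fin d) ℂ, ∀ ε, toC (C ε) * blockUU V = (ε : ℂ) • C₄

/-- No left eigenvector `x` of `A` in the column span of `W` has `x' B = 0`. For a simple
eigenvalue this is `U_i' B ≠ 0`; for a multiple one it does not depend on the choice of the
eigenvectors. -/
def AllControllable {N p l : ℕ} (A : Matrix (Fin N) (Fin N) ℝ) (W : Matrix (Fin N) (Fin l) ℂ)
    (B : Matrix (Fin N) (Fin p) ℝ) : Prop :=
  ∀ (μ : ℂ) (w : Fin l → ℂ), W *ᵥ w ≠ 0 → (W *ᵥ w) ᵥ* toC A = μ • (W *ᵥ w) →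
    (W *ᵥ w) ᵥ* toC B ≠ 0

/-- No right eigenvector `x` of `A` in the column span of `W` has `C x = 0`. -/
def AllObservable {N q l : ℕ} (A : Matrix (Fin N) (Fin N) ℝ) (W : Matrix (Fin N) (Fin l) ℂ)
    (C : Matrix (Fin q) (Fin N) ℝ) : Prop :=
  ∀ (μ : ℂ) (w : Fin l → ℂ), W *ᵥ w ≠ 0 → toC A *ᵥ (W *ᵥ w) = μ • (W *ᵥ w) →
    toC C *ᵥ (W *ᵥ w) ≠ 0

/-- Gaussian white noise: all components at all times are independent centered Gaussian random
variables with the same positive variance. -/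
def IsWhiteNoise {Ω : Type*} [MeasurableSpace Ω] (P : Measure Ω) {r : ℕ}
    (w : ℕ → Ω → Fin r → ℝ) : Prop :=
  (∃ s : ℝ≥0, s ≠ 0 ∧ ∀ k j, HasLaw (fun ω => w k ω j) (gaussianReal 0 s) P) ∧
  iIndepFun (fun (kj : ℕ × Fin r) ω => w kj.1 ω kj.2) P

/-- The matrix `E₁` of the expansion `H ε = H 0 + ε E₁ + O(ε²)`. -/
def firstOrderTerm {n m : ℕ} (H : ℝ → Matrix (Fin n) (Fin m) ℝ) : Matrix (Fin n) (Fin m) ℝ :=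
  Matrix.of fun i j => deriv (fun ε => H ε i j) 0

/-- `L_o' E₁ R_o ≠ 0`, where the columns of `L_o` and `R_o` are bases of the kernels of `(H 0)'`
and of `H 0` (the singular vectors of `H 0` for the singular value zero). The largest singular
value of `L_o' E₁ R_o`, for orthonormal bases, is the first-order coefficient in `ε` of the largest
singular value of `H ε` that vanishes at `ε = 0`. -/
def FirstOrderNonzero {n m : ℕ} (H : ℝ → Matrix (Fin n) (Fin m) ℝ) : Prop :=
  ∃ (x : Fin n → ℝ) (y : Fin m → ℝ),
    x ᵥ* H 0 = 0 ∧ H 0 *ᵥ y = 0 ∧ x ⬝ᵥ (firstOrderTerm H *ᵥ y) ≠ 0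

end RPOD

end

/-! Inserting `V * Uᵀ = 1` between the factors splits `Zᵀ * X` over the four groups of modes, with
orders `1, ε, ε, ε²`. So `H ε = H 0 + ε E₁ + ε² E₂`, and `H 0` factors through the `l` controllable
and observable modes.

Rank: almost surely `H 0` has rank exactly `l`. The determinant of the first `l` modal snapshots is
a polynomial in finitely many Gaussian samples, so it is almost surely nonzero unless it vanishes
identically (`ae_pi_ne_zero`). That it does not vanish identically, for arbitrary snapshot times,
follows from the Popov–Belevitch–Hautus condition by differentiating a supposed dependence along
impulse inputs (`IsPBH.exists_linearIndependent`). The adjoint snapshots are the same statement for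
the transposed system.

Singular values: test subspaces built from the kernel of `H 0` and its complement give `σ_l ≥ c >
0`, `σ_{l+1} = O(ε)` and, when `E₁` pairs kernel and cokernel nontrivially, `|ε| = O(σ_{l+1})`.

Error: the reduced model is a projection with `S * T = 1`, where `S` and `T` are bounded because
`σ_l` is. In modal coordinates the blocks `S V_co` and `U_co' T` are inverse to each other up to
`O(ε)`, so the reduced model is, up to `O(ε)`, similar to the diagonal model of the controllable and
observable modes; the Markov parameters of the full system also agree with those of this model up to
`O(ε)`. Stability makes the estimate uniform in the power (`norm_reduced_markov_sub_le`). The bound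
by `σ_{l+1}` then comes only from `|ε| = O(σ_{l+1})`. -/

namespace RPOD

/-! ### Courant–Fischer type bounds for singular values. -/

section SingularValues

open Module

variable {E F : Type*} [NormedAddCommGroup E] [InnerProductSpace ℝ E] [FiniteDimensional ℝ E]
  [NormedAddCommGroup F] [InnerProductSpace ℝ F] [FiniteDimensional ℝ F]

/-- Dimension count: fewer linear conditions are imposed than `W` has dimensions. This is the
intersection step of both min-max bounds. -/
lemma exists_mem_ne_zero_repr_eq_zero {n : ℕ} (b : OrthonormalBasis (Fin n) ℝ E)
    (W : Submodule ℝ E) (p : Fin n → Prop) [DecidablePred p]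
    (h : Fintype.card {i // p i} < finrank ℝ W) :
    ∃ x ∈ W, x ≠ 0 ∧ ∀ i, p i → b.repr x i = 0 := by
  let f : W →ₗ[ℝ] ({i // p i} → ℝ) :=
    LinearMap.pi fun i => (b.toBasis.coord i).comp W.subtype
  have hf : LinearMap.ker f ≠ ⊥ := LinearMap.ker_ne_bot_of_finrank_lt (by simpa using h)
  obtain ⟨x, hx, hx0⟩ := (Submodule.ne_bot_iff _).1 hf
  refine ⟨x, x.2, by simpa using hx0, fun i hi => ?_⟩
  have := congrFun (LinearMap.mem_ker.1 hx) ⟨i, hi⟩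
  simpa [f] using this

/-- The eigenbasis of `T* T` diagonalizes the quadratic form `‖T x‖²`, with eigenvalues `σ_i²`. -/
lemma sq_norm_eq_sum_singularValues (T : E →ₗ[ℝ] F) (x : E) :
    ‖T x‖ ^ 2 = ∑ i : Fin (finrank ℝ E), T.singularValues i ^ 2 *
      ((T.isSymmetric_adjoint_comp_self.eigenvectorBasis rfl).repr x i) ^ 2 := by
  set b := T.isSymmetric_adjoint_comp_self.eigenvectorBasis rfl
  have h1 : ‖T x‖ ^ 2 = inner ℝ ((LinearMap.adjoint T ∘ₗ T) x) x := by
    rw [LinearMap.comp_apply, LinearMap.adjoint_inner_left, real_inner_self_eq_norm_sq]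
  rw [h1, ← b.repr.inner_map_map, PiLp.inner_apply]
  refine Finset.sum_congr rfl fun i _ => ?_
  have := T.isSymmetric_adjoint_comp_self.eigenvectorBasis_apply_self_apply rfl x i
  rw [this, T.sq_singularValues_fin rfl]
  simp
  ring

omit [FiniteDimensional ℝ E] in
lemma sq_norm_eq_sum_repr {n : ℕ} (b : OrthonormalBasis (Fin n) ℝ E) (x : E) :
    ‖x‖ ^ 2 = ∑ i, (b.repr x i) ^ 2 := by
  rw [← b.repr.norm_map, EuclideanSpace.norm_sq_eq]
  simp

/-- A lower bound for a singular value from a subspace on which the map is bounded below. -/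
lemma le_singularValues (T : E →ₗ[ℝ] F) (W : Submodule ℝ E) {c : ℝ} {k : ℕ}
    (hk : k < finrank ℝ W) (h : ∀ x ∈ W, c * ‖x‖ ≤ ‖T x‖) : c ≤ T.singularValues k := by
  by_contra! hlt
  have hc : 0 < c := (T.singularValues_nonneg k).trans_lt hlt
  set b := T.isSymmetric_adjoint_comp_self.eigenvectorBasis rfl
  have hcard : Fintype.card {i : Fin (finrank ℝ E) // (i : ℕ) < k} ≤ k := by
    simpa using Fintype.card_le_of_injective
      (fun i : {i : Fin (finrank ℝ E) // (i : ℕ) < k} => (⟨i.1, i.2⟩ : Fin k))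
      (fun i j hij => by ext; simpa using hij)
  -- With the first `k` coordinates gone, only `σ_i ≤ σ_k` contribute to `‖T x‖`.
  obtain ⟨x, hxW, hx0, hx⟩ := exists_mem_ne_zero_repr_eq_zero b W (fun i => (i : ℕ) < k)
    (hcard.trans_lt hk)
  have h1 : ‖T x‖ ^ 2 ≤ T.singularValues k ^ 2 * ‖x‖ ^ 2 := by
    rw [sq_norm_eq_sum_singularValues, sq_norm_eq_sum_repr b, Finset.mul_sum]
    refine Finset.sum_le_sum fun i _ => ?_
    by_cases hi : (i : ℕ) < k
    · have := hx i hi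
      simp only [b] at this ⊢
      rw [this]; simp
    · have := T.singularValues_antitone (not_lt.1 hi)
      have := T.singularValues_nonneg i
      gcongr
  have hxn : 0 < ‖x‖ := norm_pos_iff.2 hx0
  have h2 : ‖T x‖ ≤ T.singularValues k * ‖x‖ := by
    rw [← mul_pow] at h1
    exact le_of_sq_le_sq h1 (mul_nonneg (T.singularValues_nonneg k) hxn.le)
  have := h x hxW
  nlinarith

/-- An upper bound for a singular value from a subspace on which the map is bounded above. -/
lemma singularValues_le (T : E →ₗ[ℝ] F) (W : Submodule ℝ E) {c : ℝ} {k : ℕ} (hc : 0 ≤ c)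
    (hk : finrank ℝ E ≤ k + finrank ℝ W) (h : ∀ x ∈ W, ‖T x‖ ≤ c * ‖x‖) :
    T.singularValues k ≤ c := by
  by_contra! hlt
  -- Past the dimension the singular values are `0` by convention, which already contradicts `hlt`.
  have hkn : k < finrank ℝ E := by
    by_contra! hkn
    rw [T.singularValues_of_finrank_le hkn] at hlt
    linarith
  set b := T.isSymmetric_adjoint_comp_self.eigenvectorBasis rfl
  have hcard : Fintype.card {i : Fin (finrank ℝ E) // k < (i : ℕ)} ≤ finrank ℝ E - (k + 1) := by
    simpa only [Fintype.card_fin] using Fintype.card_le_of_injective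
      (fun i : {i : Fin (finrank ℝ E) // k < (i : ℕ)} =>
        (⟨i.1 - (k + 1), by have := i.2; have := i.1.2; omega⟩ : Fin (finrank ℝ E - (k + 1))))
      (fun i j hij => by
        have := i.2
        have := j.2
        ext
        simp only [Fin.mk.injEq] at hij
        omega)
  obtain ⟨x, hxW, hx0, hx⟩ := exists_mem_ne_zero_repr_eq_zero b W (fun i => k < (i : ℕ))
    (by omega)
  have h1 : T.singularValues k ^ 2 * ‖x‖ ^ 2 ≤ ‖T x‖ ^ 2 := by
    rw [sq_norm_eq_sum_singularValues, sq_norm_eq_sum_repr b, Finset.mul_sum]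
    refine Finset.sum_le_sum fun i _ => ?_
    by_cases hi : k < (i : ℕ)
    · have := hx i hi
      simp only [b] at this ⊢
      rw [this]; simp
    · have := T.singularValues_antitone (not_lt.1 hi)
      have := T.singularValues_nonneg k
      gcongr
  have hxn : 0 < ‖x‖ := norm_pos_iff.2 hx0
  have h2 : T.singularValues k * ‖x‖ ≤ ‖T x‖ := by
    rw [← mul_pow] at h1
    exact le_of_sq_le_sq h1 (norm_nonneg _)
  have := h x hxW
  nlinarith

end SingularValues

/-! ### Zero sets of polynomials are null sets. -/

section Polynomial

open Polynomial

lemma exists_polynomial_eval_eq_det {κ : Type*} [Fintype κ] [DecidableEq κ]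
    (A B : Matrix κ κ ℂ) : ∃ q : ℂ[X], ∀ τ : ℝ, (A + τ • B).det = q.eval (τ : ℂ) := by
  refine ⟨((A.map (⇑C) + (X : ℂ[X]) • B.map (⇑C) : Matrix κ κ ℂ[X])).det, fun τ => ?_⟩
  rw [← coe_evalRingHom (τ : ℂ), RingHom.map_det]
  congr 1
  ext i j
  simp
  exact mul_comm _ _

/-- The zero set of a nonzero function that is polynomial in each variable is null for products of
measures without atoms. -/
lemma ae_pi_ne_zero : ∀ {n : ℕ} (μ : Fin n → Measure ℝ) [∀ i, SigmaFinite (μ i)]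
    [∀ i, NullSingletonClass (μ i)] (f : (Fin n → ℝ) → ℂ), Continuous f →
    (∀ x i, ∃ q : ℂ[X], ∀ τ : ℝ, f (Function.update x i τ) = q.eval (τ : ℂ)) →
    (∃ x, f x ≠ 0) → ∀ᵐ x ∂(Measure.pi μ), f x ≠ 0
  | 0, μ, _, _, f, _, _, ⟨x₀, hx₀⟩ => by
    refine Filter.Eventually.of_forall fun x => ?_
    rwa [Subsingleton.elim x x₀]
  | n + 1, μ, _, _, f, hf, hpoly, ⟨x₀, hx₀⟩ => by
    have hmp := measurePreserving_piFinSuccAbove μ 0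
    let e := MeasurableEquiv.piFinSuccAbove (fun _ : Fin (n + 1) => ℝ) 0
    have hcons : Continuous fun y : ℝ × (Fin n → ℝ) => (Fin.cons y.1 y.2 : Fin (n + 1) → ℝ) := by
      refine continuous_pi fun i => ?_
      refine Fin.cases ?_ (fun i => ?_) i
      · simpa using continuous_fst
      · simp only [Fin.cons_succ]
        fun_prop
    let g : ℝ × (Fin n → ℝ) → ℂ := fun y => f (Fin.cons y.1 y.2)
    have hg : Continuous g := hf.comp hcons
    have hS : MeasurableSet {y : ℝ × (Fin n → ℝ) | g y ≠ 0} :=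
      (isOpen_ne_fun hg continuous_const).measurableSet
    have key : ∀ᵐ y ∂((μ 0).prod (Measure.pi fun j => μ (Fin.succAbove 0 j))), g y ≠ 0 := by
      refine (Measure.ae_prod_mem_iff_ae_ae_mem hS).2 ?_
      -- Fubini: off the finitely many roots of `q`, the slice at `a` is nonzero at the tail of
      -- `x₀`, so the induction hypothesis applies to that slice.
      obtain ⟨q, hq⟩ := hpoly x₀ 0
      have hq0 : q ≠ 0 := by
        rintro rfl
        have := hq (x₀ 0)
        simp at this
        exact hx₀ this
      have hfin : {a : ℝ | q.eval (a : ℂ) = 0}.Finite := by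
        have : ((fun a : ℝ => (a : ℂ)) ⁻¹' (q.rootSet ℂ)).Finite :=
          (q.rootSet_finite ℂ).preimage Complex.ofReal_injective.injOn
        refine this.subset fun a ha => ?_
        simpa [mem_rootSet, hq0] using ha
      have hae : ∀ᵐ a : ℝ ∂(μ 0), q.eval (a : ℂ) ≠ 0 := by
        rw [ae_iff]
        simp only [not_not]
        exact hfin.measure_zero (μ 0)
      filter_upwards [hae] with a ha
      refine ae_pi_ne_zero (fun j => μ (Fin.succAbove 0 j)) (fun x' => g (a, x'))
        (hg.comp (by fun_prop)) (fun x' i => ?_) ⟨fun i => x₀ i.succ, ?_⟩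
      · obtain ⟨r, hr⟩ := hpoly (Fin.cons a x') i.succ
        refine ⟨r, fun τ => ?_⟩
        rw [← hr, ← Fin.cons_update]
      · rw [← hq a] at ha
        convert ha using 2
        funext i
        refine Fin.cases ?_ (fun i => ?_) i
        · simp
        · simp
    have := hmp.quasiMeasurePreserving.ae key
    filter_upwards [this] with x hx
    convert hx using 2
    funext i
    refine Fin.cases ?_ (fun i => ?_) i
    · simp [MeasurableEquiv.piFinSuccAbove]
    · simp [MeasurableEquiv.piFinSuccAbove, Fin.tail]

end Polynomial

/-- A determinant that depends linearly on finitely many white noise samples, through its matrix,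
almost surely does not vanish, unless it vanishes identically. -/
lemma IsWhiteNoise.ae_det_ne_zero {Ω : Type*} [MeasurableSpace Ω] {P : Measure Ω}
    [IsProbabilityMeasure P] {r : ℕ} {w : ℕ → Ω → Fin r → ℝ} (hw : IsWhiteNoise P w)
    {κ : Type*} [Fintype κ] [DecidableEq κ] (Y : (ℕ → Fin r → ℝ) →ₗ[ℝ] Matrix κ κ ℂ) (T : ℕ)
    (hY : ∀ u u', (∀ k < T, u k = u' k) → Y u = Y u') (hne : ∃ u, (Y u).det ≠ 0) :
    ∀ᵐ ω ∂P, (Y fun k => w k ω).det ≠ 0 := by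
  obtain ⟨⟨s, hs, hlaw⟩, hind⟩ := hw
  obtain ⟨u₀, hu₀⟩ := hne
  let idx : Fin (T * r) → ℕ × Fin r := fun i =>
    ((finProdFinEquiv.symm i).1, (finProdFinEquiv.symm i).2)
  have hidx : Function.Injective idx := by
    intro i j hij
    apply finProdFinEquiv.symm.injective
    simp only [idx, Prod.mk.injEq] at hij
    exact Prod.ext (Fin.ext hij.1) hij.2
  -- Samples at times `≥ T` are filled with `0`; by `hY` they do not affect `Y`, so only a finite
  -- product of Gaussians matters.
  let ext : (Fin (T * r) → ℝ) →ₗ[ℝ] (ℕ → Fin r → ℝ) :=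
    { toFun := fun x k j => if h : k < T then x (finProdFinEquiv (⟨k, h⟩, j)) else 0
      map_add' := fun x y => by
        funext k j
        by_cases h : k < T <;> simp [h]
      map_smul' := fun c x => by
        funext k j
        by_cases h : k < T <;> simp [h] }
  have hext : ∀ u : ℕ → Fin r → ℝ, Y (ext fun i => u (idx i).1 (idx i).2) = Y u := by
    intro u
    refine hY _ _ fun k hk => ?_
    funext j
    simp only [ext, LinearMap.coe_mk, AddHom.coe_mk, hk, dite_true, idx, Equiv.symm_apply_apply]
  let G := Y ∘ₗ ext
  have hlaws : ∀ i, HasLaw (fun ω => w (idx i).1 ω (idx i).2) (gaussianReal 0 s) P :=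
    fun i => hlaw _ _
  have hmap := (hind.precomp hidx).map_fun_eq_pi_map (fun i => (hlaws i).aemeasurable)
  have hns : NullSingletonClass (gaussianReal 0 s) := nullSingletonClass_gaussianReal hs
  have hae := ae_pi_ne_zero (fun _ : Fin (T * r) => gaussianReal 0 s) (fun x => (G x).det)
    (by
      have : Continuous G := G.continuous_of_finiteDimensional
      exact this.matrix_det)
    -- As a function of one coordinate the matrix is affine, `G (update x i 0) + τ G (e_i)`, so its
    -- determinant is a polynomial in `τ`.
    (fun x i => by
      obtain ⟨q, hq⟩ := exists_polynomial_eval_eq_det (G (Function.update x i 0))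
        (G (Pi.single i 1))
      refine ⟨q, fun τ => ?_⟩
      rw [← hq, ← map_smul, ← map_add]
      congr 2
      funext j
      by_cases h : j = i
      · subst h; simp
      · simp [h])
    ⟨fun i => u₀ (idx i).1 (idx i).2, by simpa only [G, LinearMap.comp_apply, hext] using hu₀⟩
  have hmap' : P.map (fun ω i => w (idx i).1 ω (idx i).2)
      = Measure.pi fun _ : Fin (T * r) => gaussianReal 0 s := by
    rw [← funext fun i => (hlaws i).map_eq]
    exact hmap
  rw [← hmap'] at hae
  have := ae_of_ae_map (aemeasurable_pi_lambda _ fun i => (hlaws i).aemeasurable) hae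
  filter_upwards [this] with ω hω
  simpa only [G, LinearMap.comp_apply, hext fun k => w k ω] using hω

/-! ### Krylov spaces and the Popov–Belevitch–Hautus condition. -/

section Krylov

variable {l : ℕ} {κ : Type*}

/-- The column `D ^ e M_c`. -/
def krylovVec (D : Fin l → ℂ) (M : Matrix (Fin l) κ ℂ) (e : ℕ) (c : κ) : Fin l → ℂ :=
  fun i => D i ^ e * M i c

/-- The span of the columns of `M, D M, …, D ^ (j - 1) M`. -/
def krylov (D : Fin l → ℂ) (M : Matrix (Fin l) κ ℂ) (j : ℕ) : Submodule ℂ (Fin l → ℂ) :=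
  Submodule.span ℂ {x | ∃ e < j, ∃ c, x = krylovVec D M e c}

lemma krylov_mono (D : Fin l → ℂ) (M : Matrix (Fin l) κ ℂ) : Monotone (krylov D M) :=
  fun _ _ hij => Submodule.span_mono fun _ ⟨e, he, c, hx⟩ => ⟨e, he.trans_le hij, c, hx⟩

/-- The Popov–Belevitch–Hautus condition for the pair of a diagonal matrix and `M`. -/
def IsPBH [Fintype κ] (D : Fin l → ℂ) (M : Matrix (Fin l) κ ℂ) : Prop :=
  ∀ (μ : ℂ) (w : Fin l → ℂ), w ≠ 0 → (∀ j, D j * w j = μ * w j) → w ᵥ* M ≠ 0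

/-- A Krylov space that stops growing is invariant under `D`. If it is proper, its annihilator is a
nonzero space invariant under the dual map, so over `ℂ` it contains an eigenvector. That eigenvector
kills the columns of `M`, contrary to the condition. -/
lemma IsPBH.krylov_lt [Fintype κ] {D : Fin l → ℂ} {M : Matrix (Fin l) κ ℂ} (h : IsPBH D M) {j : ℕ}
    (hj : krylov D M j ≠ ⊤) : krylov D M j < krylov D M (j + 1) := by
  refine lt_of_le_of_ne (krylov_mono D M j.le_succ) fun heq => ?_
  let f : Module.End ℂ (Fin l → ℂ) := Matrix.toLin' (Matrix.diagonal D)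
  have hf : ∀ x i, f x i = D i * x i := fun x i => by simp [f, Matrix.mulVec_diagonal]
  have hinv : ∀ x ∈ krylov D M j, f x ∈ krylov D M j := by
    intro x hx
    suffices krylov D M j ≤ (krylov D M j).comap f from this hx
    refine Submodule.span_le.2 ?_
    rintro _ ⟨e, he, c, rfl⟩
    rw [SetLike.mem_coe, Submodule.mem_comap, heq]
    refine Submodule.subset_span ⟨e + 1, by omega, c, ?_⟩
    funext i
    rw [hf]
    simp only [krylovVec]
    ring
  let Q := (krylov D M j).dualAnnihilator
  have hQ : Q ≠ ⊥ := by
    intro hbot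
    apply hj
    rwa [← Submodule.dualAnnihilator_top, Subspace.dualAnnihilator_inj] at hbot
  have hQinv : ∀ φ ∈ Q, f.dualMap φ ∈ Q := by
    intro φ hφ
    rw [Submodule.mem_dualAnnihilator] at hφ ⊢
    intro x hx
    exact hφ _ (hinv x hx)
  have : Nontrivial Q := Submodule.nontrivial_iff_ne_bot.2 hQ
  obtain ⟨μ, hμ⟩ := Module.End.exists_eigenvalue (LinearMap.restrict f.dualMap hQinv)
  obtain ⟨φ, hφ⟩ := hμ.exists_hasEigenvector
  have hφμ : ∀ x, φ.1 (f x) = μ * φ.1 x := by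
    intro x
    have := congrArg (fun ψ : Q => ψ.1 x) hφ.apply_eq_smul
    simpa using this
  have hsum : ∀ x : Fin l → ℂ, φ.1 x = ∑ i, x i * φ.1 (Pi.single i 1) := by
    intro x
    conv_lhs => rw [← (Pi.basisFun ℂ (Fin l)).sum_repr x, map_sum]
    simp
  refine h μ (fun i => φ.1 (Pi.single i 1)) ?_ ?_ ?_
  · intro h0
    apply hφ.2
    ext x
    have := hsum (Pi.single x 1)
    simp only [funext_iff, Pi.zero_apply] at h0
    simp [h0]
  · intro i
    rw [← hφμ]
    have : f (Pi.single i 1) = D i • Pi.single i (1 : ℂ) := by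
      funext k
      rw [hf]
      by_cases hk : k = i
      · subst hk; simp
      · simp [hk]
    rw [this, map_smul, smul_eq_mul]
  · funext c
    -- For `j = 0` the Krylov space is spanned by nothing; the columns of `M` enter through `heq`.
    have h1 : krylovVec D M 0 c ∈ krylov D M j := by
      rw [heq]
      exact Submodule.subset_span ⟨0, by omega, c, rfl⟩
    have := (Submodule.mem_dualAnnihilator _).1 φ.2 _ h1
    rw [hsum] at this
    simpa [krylovVec, Matrix.vecMul, dotProduct, mul_comm] using this

/-- If `W` were proper, the Krylov spaces inside it would gain a dimension at each of `r` steps,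
exceeding the dimension of `W`. -/
lemma IsPBH.eq_top_of_krylovVec_mem [Fintype κ] {D : Fin l → ℂ} {M : Matrix (Fin l) κ ℂ}
    (h : IsPBH D M) {W : Submodule ℂ (Fin l → ℂ)} {r : ℕ} (hr : Module.finrank ℂ W < r)
    (hW : ∀ e < r, ∀ c, krylovVec D M e c ∈ W) : W = ⊤ := by
  by_contra hne
  have hle : ∀ j ≤ r, krylov D M j ≤ W := fun j hj => Submodule.span_le.2 <| by
    rintro _ ⟨e, he, c, rfl⟩
    exact hW e (he.trans_le hj) c
  have hdim : ∀ j ≤ r, j ≤ Module.finrank ℂ (krylov D M j) := by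
    intro j
    induction j with
    | zero => simp
    | succ j ih =>
      intro hj
      have hlt := h.krylov_lt (j := j)
        (fun htop => hne (top_le_iff.1 (htop ▸ hle j (by omega))))
      have := Submodule.finrank_lt_finrank_of_lt hlt
      have := ih (by omega)
      omega
  have := hdim r le_rfl
  have := Submodule.finrank_mono (hle r le_rfl)
  omega

end Krylov

/-! ### Diagonal systems as linear functions of the input. -/

section ModalState

variable {ι κ : Type*} [Fintype κ]

/-- The state of `y_k = D y_{k-1} + M u_k`, `y_0 = 0`, for a diagonal matrix `D`, as a linear
function of the input. -/
def modalState (D : ι → ℂ) (M : Matrix ι κ ℂ) (k : ℕ) : (ℕ → κ → ℝ) →ₗ[ℝ] (ι → ℂ) where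
  -- The exponent `e` is the age of a sample: the times `k - e` run over `1, …, k`, and `u 0` never
  -- enters.
  toFun u i := ∑ e ∈ Finset.range k, D i ^ e * ∑ c, M i c * (u (k - e) c : ℂ)
  map_add' u u' := by
    funext i
    simp [mul_add, Finset.sum_add_distrib]
  map_smul' a u := by
    funext i
    simp [Finset.mul_sum, mul_left_comm]

lemma modalState_apply (D : ι → ℂ) (M : Matrix ι κ ℂ) (k : ℕ) (u : ℕ → κ → ℝ) (i : ι) :
    modalState D M k u i = ∑ e ∈ Finset.range k, D i ^ e * ∑ c, M i c * (u (k - e) c : ℂ) := rfl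

lemma modalState_zero (D : ι → ℂ) (M : Matrix ι κ ℂ) (u : ℕ → κ → ℝ) :
    modalState D M 0 u = 0 := by
  funext i
  simp [modalState_apply]

lemma modalState_succ (D : ι → ℂ) (M : Matrix ι κ ℂ) (k : ℕ) (u : ℕ → κ → ℝ) (i : ι) :
    modalState D M (k + 1) u i = D i * modalState D M k u i + ∑ c, M i c * (u (k + 1) c : ℂ) := by
  simp only [modalState_apply, Finset.sum_range_succ', Finset.mul_sum (s := Finset.range k)]
  simp [pow_succ', mul_assoc]

lemma modalState_smul (D : ι → ℂ) (M : Matrix ι κ ℂ) (a : ℂ) (k : ℕ) (u : ℕ → κ → ℝ) :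
    modalState D (a • M) k u = a • modalState D M k u := by
  funext i
  simp [modalState_apply, Finset.mul_sum, mul_left_comm, mul_assoc]

lemma modalState_congr (D : ι → ℂ) (M : Matrix ι κ ℂ) (k : ℕ) {u u' : ℕ → κ → ℝ}
    (h : ∀ i ≤ k, u i = u' i) : modalState D M k u = modalState D M k u' := by
  funext i
  simp only [modalState_apply]
  refine Finset.sum_congr rfl fun e _ => ?_
  rw [h (k - e) (by omega)]

/-- The state is linear in the input, so its derivative in the direction of an impulse is a Krylov
vector, or zero if the impulse comes later than the snapshot. -/
lemma modalState_impulse [DecidableEq κ] {l : ℕ} (D : Fin l → ℂ) (M : Matrix (Fin l) κ ℂ)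
    (k τ : ℕ) (hτ : 1 ≤ τ) (c : κ) :
    modalState D M k (Pi.single τ (Pi.single c 1)) =
      if τ ≤ k then krylovVec D M (k - τ) c else 0 := by
  funext i
  rw [modalState_apply]
  split_ifs with h
  · rw [Finset.sum_eq_single (k - τ)]
    · rw [show k - (k - τ) = τ by omega]
      have : ∑ x, M i x * (((Pi.single c (1 : ℝ) : κ → ℝ) x : ℝ) : ℂ) = M i c := by
        rw [Finset.sum_eq_single c (fun x _ hx => by simp [hx]) (by simp)]
        simp
      rw [Pi.single_eq_same, this]
      rfl
    · intro e he hne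
      rw [Finset.mem_range] at he
      rw [Pi.single_eq_of_ne (by omega)]
      simp
    · intro hk
      rw [Finset.mem_range] at hk
      omega
  · refine Finset.sum_eq_zero fun e _ => ?_
    rw [Pi.single_eq_of_ne (by omega)]
    simp

end ModalState

/-! ### Generic independence of snapshots at arbitrary times. -/

section Generic

open Filter Topology

/-- If `y` depends linearly on a parameter and generically lies in the span of the independent
vectors `Y j`, then the derivative of this relation lies in the same span. -/
lemma sub_sum_mem_span {E V : Type*} [AddCommGroup E] [Module ℝ E] [NormedAddCommGroup V]
    [NormedSpace ℂ V] [NormedSpace ℝ V] [IsScalarTower ℝ ℂ V] {r : ℕ} (Y : Fin r → E →ₗ[ℝ] V)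
    (y : E →ₗ[ℝ] V)
    (hmem : ∀ u, LinearIndependent ℂ (fun j => Y j u) →
      y u ∈ Submodule.span ℂ (Set.range fun j => Y j u))
    (u h : E) (hu : LinearIndependent ℂ (fun j => Y j u)) (c : Fin r → ℂ)
    (hc : y u = ∑ j, c j • Y j u) :
    y h - ∑ j, c j • Y j h ∈ Submodule.span ℂ (Set.range fun j => Y j u) := by
  set d := y h - ∑ j, c j • Y j h with hd
  by_contra hnot
  -- If `d` were outside the span, `v 0` would be independent, and independence is an open
  -- condition, so it would persist for small `τ ≠ 0`.
  let v : ℝ → Fin (r + 1) → V := fun τ => Fin.cons d (fun j => Y j u + τ • Y j h)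
  have hv : Continuous v := by
    refine continuous_pi fun i => ?_
    refine Fin.cases ?_ (fun i => ?_) i
    · simpa [v] using continuous_const
    · simp only [v, Fin.cons_succ]
      fun_prop
  have h0 : LinearIndependent ℂ (v 0) := by
    simp only [v]
    rw [linearIndependent_finCons]
    simpa using ⟨hu, hnot⟩
  have hev : ∀ᶠ τ in 𝓝 (0 : ℝ), LinearIndependent ℂ (v τ) :=
    hv.continuousAt.eventually ((isOpen_setOfPred_linearIndependent).mem_nhds h0)
  have hev' : ∀ᶠ τ in 𝓝[≠] (0 : ℝ), LinearIndependent ℂ (v τ) ∧ τ ≠ 0 :=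
    (hev.filter_mono nhdsWithin_le_nhds).and self_mem_nhdsWithin
  obtain ⟨τ, hτ, hτ0⟩ := hev'.exists
  simp only [v] at hτ
  rw [linearIndependent_finCons] at hτ
  obtain ⟨hτ1, hτ2⟩ := hτ
  have heq : ∀ j, Y j u + τ • Y j h = Y j (u + τ • h) := fun j => by simp
  simp only [heq] at hτ1 hτ2
  apply hτ2
  have h1 := hmem _ hτ1
  -- The zeroth order cancels by `hc`; at `u + τ h` the hypothesis then puts `τ d` into the moved
  -- span, the contradiction.
  have h2 : (τ : ℂ) • d = y (u + τ • h) - ∑ j, c j • Y j (u + τ • h) := by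
    have hr : ∀ x : V, τ • x = (τ : ℂ) • x := fun x => (algebraMap_smul ℂ τ x).symm
    simp only [hd, map_add, map_smul, smul_add, Finset.sum_add_distrib, ← hc, smul_sub,
      Finset.smul_sum, hr, smul_comm (c _) (τ : ℂ)]
    abel
  have h3 : (τ : ℂ) • d ∈ Submodule.span ℂ (Set.range fun j => Y j (u + τ • h)) := by
    rw [h2]
    refine Submodule.sub_mem _ h1 (Submodule.sum_mem _ fun j _ => Submodule.smul_mem _ _ ?_)
    exact Submodule.subset_span ⟨j, rfl⟩
  exact (Submodule.smul_mem_iff _ (by exact_mod_cast hτ0)).1 h3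

/-- Snapshots at arbitrary times of a controllable diagonal system are linearly independent for
some input. -/
lemma IsPBH.exists_linearIndependent {l : ℕ} {κ : Type*} [Fintype κ] {D : Fin l → ℂ}
    {M : Matrix (Fin l) κ ℂ} (h : IsPBH D M) : ∀ {r : ℕ}, r ≤ l → ∀ t : Fin r → ℕ, StrictMono t →
    (∀ k, 1 ≤ t k) → ∃ u, LinearIndependent ℂ (fun k => modalState D M (t k) u)
  | 0, _, _, _, _ => ⟨0, linearIndependent_empty_type⟩
  | r + 1, hr, t, ht, ht1 => by
    classical
    obtain ⟨u, hu⟩ := h.exists_linearIndependent (by omega) (fun k : Fin r => t k.castSucc)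
      (fun i j hij => ht (Fin.castSucc_lt_castSucc_iff.2 hij)) (fun k => ht1 _)
    by_contra! hno
    have hmem : ∀ u, LinearIndependent ℂ (fun k : Fin r => modalState D M (t k.castSucc) u) →
        modalState D M (t (Fin.last r)) u ∈
          Submodule.span ℂ (Set.range fun k : Fin r => modalState D M (t k.castSucc) u) := by
      intro u hu
      by_contra hnot
      exact hno u (linearIndependent_finSucc'.2 ⟨hu, hnot⟩)
    let W := Submodule.span ℂ (Set.range fun k : Fin r => modalState D M (t k.castSucc) u)
    obtain ⟨c, hc⟩ := (Submodule.mem_span_range_iff_exists_fun ℂ).1 (hmem u hu)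
    -- An impulse at time `t_r - e` adds `D ^ e M_c` to the last snapshot and to the earlier ones
    -- only Krylov vectors of smaller exponent, which lie in `W` by induction.
    have hkry : ∀ e < t (Fin.last r), ∀ c, krylovVec D M e c ∈ W := by
      intro e
      induction e using Nat.strong_induction_on with
      | _ e ih =>
        intro he c'
        have hd := sub_sum_mem_span (fun k : Fin r => modalState D M (t k.castSucc))
          (modalState D M (t (Fin.last r))) hmem u
          (Pi.single (t (Fin.last r) - e) (Pi.single c' 1)) hu c hc.symm
        have hlast : modalState D M (t (Fin.last r))
            (Pi.single (t (Fin.last r) - e) (Pi.single c' 1)) = krylovVec D M e c' := by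
          rw [modalState_impulse _ _ _ _ (by omega), if_pos (by omega)]
          congr 1
          omega
        rw [hlast] at hd
        refine (Submodule.sub_mem_iff_left W (Submodule.sum_mem _ fun k _ =>
          Submodule.smul_mem _ _ ?_)).1 hd
        rw [modalState_impulse _ _ _ _ (by omega)]
        have := ht (Fin.castSucc_lt_last k)
        split_ifs
        · exact ih _ (by omega) (by omega) c'
        · exact Submodule.zero_mem _
    have hfr : Module.finrank ℂ W = r := by simpa using finrank_span_eq_card hu
    -- The times increase strictly from at least `1`, so `W`, of dimension `r`, contains more than
    -- `r` Krylov generations and must be the whole space, although `r < l`.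
    have hrt : r < t (Fin.last r) := by
      have hge : ∀ k : ℕ, ∀ hk : k < r + 1, k < t ⟨k, hk⟩ := by
        intro k
        induction k with
        | zero => intro hk; exact ht1 _
        | succ k ih =>
          intro hk
          have := ih (by omega)
          have := ht (show (⟨k, by omega⟩ : Fin (r + 1)) < ⟨k + 1, hk⟩ by simp)
          omega
      exact hge r (by omega)
    have htop := h.eq_top_of_krylovVec_mem (hfr.trans_lt hrt) hkry
    rw [htop, finrank_top, Module.finrank_fin_fun] at hfr
    omega

end Generic

/-! ### Passage to modal coordinates. -/

section Modal

variable {N : ℕ} {ι : Type*} [Fintype ι] [DecidableEq ι]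

lemma toC_mul {α β γ : Type*} [Fintype β] (M : Matrix α β ℝ) (M' : Matrix β γ ℝ) :
    toC (M * M') = toC M * toC M' := Matrix.map_mul (f := Complex.ofRealHom)

/-- Exchanging `U` and `V` turns the adjoint system into a primal one, so that results on `X`
transfer to `Z`. -/
lemma IsModalDecomposition.transpose {A : Matrix (Fin N) (Fin N) ℝ} {V U : Matrix (Fin N) ι ℂ}
    {Λ : ι → ℂ} (h : IsModalDecomposition A V Λ U) : IsModalDecomposition Aᵀ U Λ V where
  left_inv := by
    rw [← Matrix.transpose_one, ← h.left_inv, Matrix.transpose_mul, Matrix.transpose_transpose]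
  right_inv := by
    rw [← Matrix.transpose_one, ← h.right_inv, Matrix.transpose_mul, Matrix.transpose_transpose]
  eq := by
    have : toC Aᵀ = (toC A)ᵀ := rfl
    rw [this, h.eq, Matrix.transpose_mul, Matrix.transpose_mul, Matrix.transpose_transpose,
      Matrix.diagonal_transpose, Matrix.mul_assoc]

lemma IsModalDecomposition.transpose_submatrix_mul {A : Matrix (Fin N) (Fin N) ℝ}
    {V U : Matrix (Fin N) ι ℂ} {Λ : ι → ℂ} (h : IsModalDecomposition A V Λ U)
    {κ : Type*} [Fintype κ] [DecidableEq κ] (f : κ → ι) :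
    (U.submatrix id f)ᵀ * toC A = Matrix.diagonal (Λ ∘ f) * (U.submatrix id f)ᵀ := by
  have h1 : Uᵀ * toC A = Matrix.diagonal Λ * Uᵀ := by
    rw [h.eq, ← Matrix.mul_assoc, ← Matrix.mul_assoc, h.left_inv, Matrix.one_mul]
  ext i j
  have := congrFun (congrFun h1 (f i)) j
  rw [Matrix.diagonal_mul] at this ⊢
  simpa [Matrix.mul_apply] using this

lemma IsModalDecomposition.pow_eq {A : Matrix (Fin N) (Fin N) ℝ}
    {V U : Matrix (Fin N) ι ℂ} {Λ : ι → ℂ} (h : IsModalDecomposition A V Λ U) (i : ℕ) :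
    toC A ^ i = V * Matrix.diagonal (Λ ^ i) * Uᵀ := by
  induction i with
  | zero => simp [h.right_inv]
  | succ i ih =>
    have : V * Matrix.diagonal (Λ ^ i) * Uᵀ * (V * Matrix.diagonal Λ * Uᵀ)
        = V * (Matrix.diagonal (Λ ^ i) * (Uᵀ * V) * Matrix.diagonal Λ) * Uᵀ := by
      simp only [Matrix.mul_assoc]
    rw [pow_succ, ih, h.eq, this, h.left_inv, Matrix.mul_one, Matrix.diagonal_mul_diagonal]
    rfl

lemma IsModalDecomposition.norm_lt_one {A : Matrix (Fin N) (Fin N) ℝ}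
    {V U : Matrix (Fin N) ι ℂ} {Λ : ι → ℂ} (h : IsModalDecomposition A V Λ U) (hA : IsStable A)
    (j : ι) : ‖Λ j‖ < 1 := by
  refine hA _ ?_
  rw [← Matrix.spectrum_toLin', ← Module.End.hasEigenvalue_iff_mem_spectrum]
  have hne : V *ᵥ Pi.single j 1 ≠ 0 := by
    intro h0
    have : Uᵀ *ᵥ (V *ᵥ Pi.single j 1) = Pi.single j 1 := by
      rw [Matrix.mulVec_mulVec, h.left_inv, Matrix.one_mulVec]
    rw [h0, Matrix.mulVec_zero] at this
    have := congrFun this j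
    simp at this
  refine Module.End.hasEigenvalue_of_hasEigenvector (x := V *ᵥ Pi.single j 1)
    (Module.End.hasEigenvector_iff.2 ⟨Module.End.mem_eigenspace_iff.2 ?_, hne⟩)
  rw [Matrix.toLin'_apply, h.eq, Matrix.mulVec_mulVec, Matrix.mul_assoc, h.left_inv,
    Matrix.mul_one, ← Matrix.mulVec_mulVec, ← Matrix.mulVec_smul]
  congr 1
  funext k
  rw [Matrix.mulVec_diagonal]
  by_cases hk : k = j
  · subst hk; simp
  · simp [hk]

/-- The modal snapshots: column `k` is the modal state at time `t k`. -/
noncomputable def modalSnapshots {κ κ' : Type*} [Fintype κ'] {m : ℕ} (D : κ → ℂ) (M : Matrix κ κ' ℂ)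
    (u : ℕ → κ' → ℝ) (t : Fin m → ℕ) : Matrix κ (Fin m) ℂ :=
  Matrix.of fun i k => modalState D M (t k) u i

lemma modalSnapshots_smul {κ κ' : Type*} [Fintype κ'] {m : ℕ} (D : κ → ℂ) (M : Matrix κ κ' ℂ)
    (a : ℂ) (u : ℕ → κ' → ℝ) (t : Fin m → ℕ) :
    modalSnapshots D (a • M) u t = a • modalSnapshots D M u t := by
  ext i k
  simp [modalSnapshots, modalState_smul]

/-- Columns of `U` are left eigenvectors, so every group of modes evolves on its own as a diagonal
system driven by its block of `U' B`. -/
lemma IsModalDecomposition.transpose_submatrix_mul_snapshots {A : Matrix (Fin N) (Fin N) ℝ}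
    {V U : Matrix (Fin N) ι ℂ} {Λ : ι → ℂ} (h : IsModalDecomposition A V Λ U)
    {κ κ' : Type*} [Fintype κ] [DecidableEq κ] [Fintype κ'] {m : ℕ} (f : κ → ι)
    (B : Matrix (Fin N) κ' ℝ) (u : ℕ → κ' → ℝ) (t : Fin m → ℕ) :
    (U.submatrix id f)ᵀ * toC (snapshots A B u t)
      = modalSnapshots (Λ ∘ f) ((U.submatrix id f)ᵀ * toC B) u t := by
  have key : ∀ k, (U.submatrix id f)ᵀ *ᵥ (fun i => (state A B u k i : ℂ))
      = modalState (Λ ∘ f) ((U.submatrix id f)ᵀ * toC B) k u := by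
    intro k
    induction k with
    | zero =>
      rw [modalState_zero]
      have : (fun i => ((state A B u 0 i : ℝ) : ℂ)) = 0 := by
        funext i
        simp [state]
      rw [this, Matrix.mulVec_zero]
    | succ k ih =>
      have hs : (fun i => ((state A B u (k + 1) i : ℝ) : ℂ))
          = toC A *ᵥ (fun i => (state A B u k i : ℂ)) + toC B *ᵥ fun c => (u (k + 1) c : ℂ) := by
        funext i
        simp [state, Matrix.mulVec, dotProduct]
      funext i
      rw [modalState_succ, ← ih, hs, Matrix.mulVec_add, Matrix.mulVec_mulVec,
        Matrix.mulVec_mulVec, h.transpose_submatrix_mul, ← Matrix.mulVec_mulVec]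
      rw [Pi.add_apply, Matrix.mulVec_diagonal]
      rfl
  ext i k
  rw [modalSnapshots, Matrix.of_apply, ← key]
  rfl

end Modal

/-! ### From controllability to almost surely independent snapshots. -/

section Controllability

variable {N p l a b d : ℕ}

/-- The map `w ↦ U_co w` is injective, with left inverse `V_co'`, and takes eigenvectors of the
diagonal block to left eigenvectors of `A`. -/
lemma AllControllable.isPBH {A : Matrix (Fin N) (Fin N) ℝ}
    {V U : Matrix (Fin N) (ModeIndex l a b d) ℂ} {Λ : ModeIndex l a b d → ℂ}
    (h : IsModalDecomposition A V Λ U) {B : Matrix (Fin N) (Fin p) ℝ}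
    (hB : AllControllable A (blockCO U) B) :
    IsPBH (fun j => Λ (Sum.inl j)) ((blockCO U)ᵀ * toC B) := by
  intro μ w hw hμ
  have hinv : (blockCO V)ᵀ * blockCO U = 1 := by
    ext i j
    have := congrFun (congrFun h.transpose.left_inv (Sum.inl i)) (Sum.inl j)
    simpa [blockCO, Matrix.mul_apply, Matrix.one_apply] using this
  have hx : blockCO U *ᵥ w = w ᵥ* (blockCO U)ᵀ := (Matrix.vecMul_transpose _ _).symm
  have := hB μ w ?_ ?_
  · rwa [hx, Matrix.vecMul_vecMul] at this
  · intro h0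
    apply hw
    rw [← Matrix.one_mulVec w, ← hinv, ← Matrix.mulVec_mulVec, h0, Matrix.mulVec_zero]
  · rw [hx, Matrix.vecMul_vecMul, blockCO, h.transpose_submatrix_mul, ← Matrix.vecMul_vecMul,
      ← Matrix.smul_vecMul]
    congr 1
    funext j
    rw [Matrix.vecMul_diagonal, Pi.smul_apply, smul_eq_mul, ← hμ j, mul_comm]
    rfl

lemma AllObservable.allControllable_transpose {q : ℕ} {A : Matrix (Fin N) (Fin N) ℝ}
    {W : Matrix (Fin N) (Fin l) ℂ} {C : Matrix (Fin q) (Fin N) ℝ} (h : AllObservable A W C) :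
    AllControllable Aᵀ W Cᵀ := by
  intro μ w hw hμ
  have hA : toC Aᵀ = (toC A)ᵀ := rfl
  have hC : toC Cᵀ = (toC C)ᵀ := rfl
  rw [hA, Matrix.vecMul_transpose] at hμ
  rw [hC, Matrix.vecMul_transpose]
  exact h μ w hw hμ

/-- The first `l` snapshots of a controllable diagonal system driven by white noise are almost
surely linearly independent. -/
lemma IsPBH.ae_det_ne_zero {D : Fin l → ℂ} {M : Matrix (Fin l) (Fin p) ℂ} (h : IsPBH D M)
    {Ω : Type*} [MeasurableSpace Ω] {P : Measure Ω} [IsProbabilityMeasure P]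
    {u : ℕ → Ω → Fin p → ℝ} (hu : IsWhiteNoise P u) {m : ℕ} {t : Fin m → ℕ} (ht : StrictMono t)
    (ht1 : ∀ k, 1 ≤ t k) (hm : l ≤ m) :
    ∀ᵐ ω ∂P, ((modalSnapshots D M (fun k => u k ω) t).submatrix id (Fin.castLE hm)).det ≠ 0 := by
  let Y : (ℕ → Fin p → ℝ) →ₗ[ℝ] Matrix (Fin l) (Fin l) ℂ :=
    { toFun := fun u => (modalSnapshots D M u t).submatrix id (Fin.castLE hm)
      map_add' := fun u u' => by
        ext i k
        simp [modalSnapshots]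
      map_smul' := fun a u => by
        ext i k
        simp [modalSnapshots] }
  -- The sum plus one is merely a horizon beyond every snapshot time.
  refine hu.ae_det_ne_zero Y (∑ k, t k + 1) (fun u u' huu => ?_) ?_
  · ext i k
    change modalState D M _ u i = modalState D M _ u' i
    rw [modalState_congr D M _ fun j hj => huu j ?_]
    have := Finset.single_le_sum (f := t) (fun _ _ => Nat.zero_le _)
      (Finset.mem_univ (Fin.castLE hm k))
    omega
  · obtain ⟨u, hu⟩ := h.exists_linearIndependent le_rfl (fun k => t (Fin.castLE hm k))
      (fun i j hij => ht hij) (fun k => ht1 _)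
    refine ⟨u, ?_⟩
    have : IsUnit (Y u) := Matrix.linearIndependent_cols_iff_isUnit.1 hu
    exact ((Matrix.isUnit_iff_isUnit_det _).1 this).ne_zero

end Controllability

/-! ### Singular values of a quadratic perturbation of a rank `l` map. -/

section Perturbation

open Module

variable {E F : Type*} [NormedAddCommGroup E] [InnerProductSpace ℝ E] [FiniteDimensional ℝ E]
  [NormedAddCommGroup F] [InnerProductSpace ℝ F] [FiniteDimensional ℝ F]

lemma exists_norm_le_mul {E G : Type*} [NormedAddCommGroup E] [NormedSpace ℝ E]
    [FiniteDimensional ℝ E] [NormedAddCommGroup G] [NormedSpace ℝ G] (T : E →ₗ[ℝ] G) :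
    ∃ M, 0 ≤ M ∧ ∀ x, ‖T x‖ ≤ M * ‖x‖ :=
  ⟨‖LinearMap.toContinuousLinearMap T‖, norm_nonneg _,
    fun x => (LinearMap.toContinuousLinearMap T).le_opNorm x⟩

omit [FiniteDimensional ℝ E] [FiniteDimensional ℝ F] in
lemma norm_perturbation_sub_le {T₀ T₁ T₂ : E →ₗ[ℝ] F} {M ε : ℝ}
    (h₁ : ∀ x, ‖T₁ x‖ ≤ M * ‖x‖) (h₂ : ∀ x, ‖T₂ x‖ ≤ M * ‖x‖) (hε : |ε| ≤ 1) (x : E) :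
    ‖(T₀ + ε • T₁ + ε ^ 2 • T₂) x - T₀ x‖ ≤ 2 * M * |ε| * ‖x‖ := by
  have : (T₀ + ε • T₁ + ε ^ 2 • T₂) x - T₀ x = ε • T₁ x + ε ^ 2 • T₂ x := by
    simp only [LinearMap.add_apply, LinearMap.smul_apply]
    abel
  rw [this]
  refine (norm_add_le _ _).trans ?_
  rw [norm_smul, norm_smul, Real.norm_eq_abs, Real.norm_eq_abs, abs_pow]
  have h0 := abs_nonneg ε
  have e1 : |ε| * ‖T₁ x‖ ≤ |ε| * (M * ‖x‖) := by gcongr; exact h₁ x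
  have e2 : |ε| ^ 2 * ‖T₂ x‖ ≤ |ε| * (M * ‖x‖) := by
    have : |ε| ^ 2 ≤ |ε| := by nlinarith
    exact mul_le_mul this (h₂ x) (norm_nonneg _) h0
  linarith

/-- Bounds for the singular values of a quadratic perturbation of a map of rank `l`. -/
theorem singularValues_perturbation (T₀ T₁ T₂ : E →ₗ[ℝ] F) (l : ℕ) (W₀ W₁ : Submodule ℝ E)
    (hW₀ : finrank ℝ W₀ = l) {c : ℝ} (hc : 0 < c) (hbelow : ∀ x ∈ W₀, c * ‖x‖ ≤ ‖T₀ x‖)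
    (hW₁ : finrank ℝ E ≤ l + finrank ℝ W₁) (hker : ∀ x ∈ W₁, T₀ x = 0) :
    ∃ K ε₀ : ℝ, 0 ≤ K ∧ 0 < ε₀ ∧ ∀ ε : ℝ, |ε| < ε₀ →
      (∀ k < l, c / 2 ≤ (T₀ + ε • T₁ + ε ^ 2 • T₂).singularValues k) ∧
      (T₀ + ε • T₁ + ε ^ 2 • T₂).singularValues l ≤ K * |ε| := by
  obtain ⟨M₁, hM₁, h₁⟩ := exists_norm_le_mul T₁
  obtain ⟨M₂, hM₂, h₂⟩ := exists_norm_le_mul T₂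
  set M := M₁ + M₂ with hM
  have h₁' : ∀ x, ‖T₁ x‖ ≤ M * ‖x‖ := fun x => (h₁ x).trans (by gcongr; linarith)
  have h₂' : ∀ x, ‖T₂ x‖ ≤ M * ‖x‖ := fun x => (h₂ x).trans (by gcongr; linarith)
  have hM0 : 0 ≤ M := by positivity
  -- The threshold makes the perturbation `2 M |ε|` at most `c / 2`; the `+ 1` keeps the denominator
  -- positive when `M = 0`.
  refine ⟨2 * M, min 1 (c / (4 * M + 1)), by positivity, by positivity, fun ε hε => ?_⟩
  have hε1 : |ε| ≤ 1 := (hε.trans_le (min_le_left _ _)).le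
  have hε2 : 2 * M * |ε| ≤ c / 2 := by
    have := hε.trans_le (min_le_right _ _)
    rw [lt_div_iff₀ (by positivity)] at this
    nlinarith [abs_nonneg ε]
  have hd := norm_perturbation_sub_le (T₀ := T₀) h₁' h₂' hε1
  refine ⟨fun k hk => le_singularValues _ W₀ (by omega) fun x hx => ?_,
    singularValues_le _ W₁ (by positivity) hW₁ fun x hx => ?_⟩
  · have e1 := hd x
    have e2 := hbelow x hx
    have e3 := norm_sub_norm_le (T₀ x) ((T₀ + ε • T₁ + ε ^ 2 • T₂) x)
    rw [norm_sub_rev] at e3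
    nlinarith [norm_nonneg x]
  · simpa [hker x hx] using hd x

/-- The scalar estimate behind `abs_le_mul_singularValues`. -/
lemma mul_add_le_of_le {c d M e w b h K₁ : ℝ} (hc : 0 < c) (hd0 : 0 < d) (hM0 : 0 ≤ M)
    (h0 : 0 ≤ e) (hε1 : e ≤ 1) (hw : 0 ≤ w) (hb0 : 0 ≤ b) (hh0 : 0 ≤ h)
    (hK₁ : K₁ = 2 / d * (M + 4 * M ^ 2 / c)) (hε2 : 2 * M * e ≤ c / 2)
    (hε3 : (M ^ 2 + 8 * M ^ 3 / c) * e ≤ d / 2) (e1 : c * w ≤ h + 2 * M * e * (w + b))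
    (e3 : e * b * d ≤ M * h + 2 * M ^ 2 * (e * w) + M ^ 2 * e * (e * b)) :
    e * (w + b) ≤ (K₁ + 2 / c * (1 + 2 * M * K₁)) * h := by
  -- In the application `e = |ε|`, `w` and `b` are the norms of the two components of a test vector,
  -- and `h` is the norm of its image. By `hε2` the `w` on the right of `e1` is absorbed on the
  -- left.
  have e2 : w ≤ 2 / c * (h + 2 * M * (e * b)) := by
    have : c / 2 * w ≤ h + 2 * M * (e * b) := by nlinarith
    rw [div_mul_eq_mul_div, le_div_iff₀ hc]
    linarith
  have e4 : e * w ≤ 2 / c * (h + 2 * M * (e * b)) * e := by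
    rw [mul_comm]
    gcongr
  have e5 : e * b ≤ K₁ * h := by
    have a1 : 2 * M ^ 2 * (e * w) ≤ 4 * M ^ 2 / c * h
        + 8 * M ^ 3 / c * e * (e * b) := by
      have a2 : 2 * M ^ 2 * (e * w)
          ≤ 2 * M ^ 2 * (2 / c * (h + 2 * M * (e * b)) * e) := by gcongr
      have a3 : 2 * M ^ 2 * (2 / c * (h + 2 * M * (e * b)) * e)
          = 4 * M ^ 2 / c * (h * e) + 8 * M ^ 3 / c * e * (e * b) := by ring
      have a4 : 4 * M ^ 2 / c * (h * e) ≤ 4 * M ^ 2 / c * h := by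
        gcongr
        exact mul_le_of_le_one_right hh0 hε1
      linarith
    -- By `hε3` the terms of second order in `e` take at most half of `d e b`.
    have a5 : (M ^ 2 + 8 * M ^ 3 / c) * e * (e * b) ≤ d / 2 * (e * b) := by gcongr
    have a6 : d / 2 * (e * b) ≤ (M + 4 * M ^ 2 / c) * h := by linarith
    rw [hK₁, div_mul_eq_mul_div, div_mul_eq_mul_div, le_div_iff₀ hd0]
    linarith
  have e6 : e * w ≤ 2 / c * (1 + 2 * M * K₁) * h := by
    calc e * w ≤ 1 * w := by gcongr
      _ ≤ 2 / c * (h + 2 * M * (e * b)) := by rw [one_mul]; exact e2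
      _ ≤ 2 / c * (h + 2 * M * (K₁ * h)) := by gcongr
      _ = _ := by ring
  linarith

/-- If the perturbation of a map of rank `l` does not vanish to first order between the kernel and
the cokernel, then the `(l+1)`-th singular value is bounded below by a multiple of `|ε|`. -/
theorem abs_le_mul_singularValues (T₀ T₁ T₂ : E →ₗ[ℝ] F) (l : ℕ) (W₀ : Submodule ℝ E)
    (hW₀ : finrank ℝ W₀ = l) {c : ℝ} (hc : 0 < c) (hbelow : ∀ x ∈ W₀, c * ‖x‖ ≤ ‖T₀ x‖)
    (φ : F →ₗ[ℝ] ℝ) (y : E) (hφ : ∀ x, φ (T₀ x) = 0) (hy : T₀ y = 0) (hφy : φ (T₁ y) ≠ 0) :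
    ∃ K ε₀ : ℝ, 0 ≤ K ∧ 0 < ε₀ ∧ ∀ ε : ℝ, |ε| < ε₀ →
      |ε| ≤ K * (T₀ + ε • T₁ + ε ^ 2 • T₂).singularValues l := by
  obtain ⟨M₁, hM₁, h₁⟩ := exists_norm_le_mul T₁
  obtain ⟨M₂, hM₂, h₂⟩ := exists_norm_le_mul T₂
  obtain ⟨M₃, hM₃, h₃⟩ := exists_norm_le_mul φ
  set M := M₁ + M₂ + M₃ with hM
  have h₁' : ∀ x, ‖T₁ x‖ ≤ M * ‖x‖ := fun x => (h₁ x).trans (by gcongr; linarith)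
  have h₂' : ∀ x, ‖T₂ x‖ ≤ M * ‖x‖ := fun x => (h₂ x).trans (by gcongr; linarith)
  have h₃' : ∀ x, |φ x| ≤ M * ‖x‖ := fun x => (h₃ x).trans (by gcongr; linarith)
  have hM0 : 0 ≤ M := by positivity
  have hy0 : y ≠ 0 := by
    rintro rfl
    simp at hφy
  have hyn : 0 < ‖y‖ := norm_pos_iff.2 hy0
  have hyW : y ∉ W₀ := by
    intro hyW
    have := hbelow y hyW
    rw [hy, norm_zero] at this
    nlinarith
  set d := |φ (T₁ y)| / ‖y‖ with hd
  have hd0 : 0 < d := div_pos (abs_pos.2 hφy) hyn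
  set K₁ := 2 / d * (M + 4 * M ^ 2 / c) with hK₁
  have hK₁0 : 0 ≤ K₁ := by positivity
  set K := K₁ + 2 / c * (1 + 2 * M * K₁) + 1 with hK
  have hK0 : 0 < K := by positivity
  set ε₀ := min 1 (min (c / (4 * M + 1)) (d / (2 * (M ^ 2 + 8 * M ^ 3 / c) + 1))) with hε₀
  refine ⟨K, ε₀, hK0.le, by positivity, fun ε hε => ?_⟩
  have h0 := abs_nonneg ε
  have hε1 : |ε| ≤ 1 := (hε.trans_le (min_le_left _ _)).le
  have hε2 : 2 * M * |ε| ≤ c / 2 := by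
    have := hε.trans_le ((min_le_right _ _).trans (min_le_left _ _))
    rw [lt_div_iff₀ (by positivity)] at this
    nlinarith
  have hε3 : (M ^ 2 + 8 * M ^ 3 / c) * |ε| ≤ d / 2 := by
    have := hε.trans_le ((min_le_right _ _).trans (min_le_right _ _))
    rw [lt_div_iff₀ (by positivity)] at this
    nlinarith
  set T := T₀ + ε • T₁ + ε ^ 2 • T₂ with hT
  -- The test space has dimension `l + 1`, as the index `l` counted from `0` needs. On `W₀` the
  -- bound comes from `T₀`, along `y` from the first-order term seen by `φ`.
  have hfr : l < finrank ℝ ↥(W₀ ⊔ Submodule.span ℝ {y}) := by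
    rw [← hW₀]
    refine Submodule.finrank_lt_finrank_of_lt (lt_of_le_of_ne le_sup_left fun heq => hyW ?_)
    rw [heq]
    exact Submodule.mem_sup_right (Submodule.mem_span_singleton_self y)
  have key : |ε| / K ≤ T.singularValues l := by
    refine le_singularValues T _ hfr fun x hx => ?_
    obtain ⟨w, hw, z, hz, rfl⟩ := Submodule.mem_sup.1 hx
    obtain ⟨β, rfl⟩ := Submodule.mem_span_singleton.1 hz
    set x := w + β • y
    set h := ‖T x‖
    set b := |β| * ‖y‖ with hb
    have hb0 : 0 ≤ b := by positivity
    have hh0 : 0 ≤ h := norm_nonneg _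
    have hxn : ‖x‖ ≤ ‖w‖ + b := by
      refine (norm_add_le _ _).trans ?_
      rw [norm_smul, Real.norm_eq_abs]
    have hT₀x : T₀ x = T₀ w := by simp [x, hy]
    have e1 : c * ‖w‖ ≤ h + 2 * M * |ε| * (‖w‖ + b) := by
      have a1 := norm_perturbation_sub_le (T₀ := T₀) h₁' h₂' hε1 x
      have a2 := norm_sub_norm_le (T₀ x) (T x)
      rw [norm_sub_rev] at a2
      have a3 := hbelow w hw
      have a4 : 2 * M * |ε| * ‖x‖ ≤ 2 * M * |ε| * (‖w‖ + b) := by gcongr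
      rw [hT₀x] at a1 a2
      linarith
    -- Applying `φ` removes `T₀`, which leaves `ε β φ (T₁ y)` as the leading contribution of `y`.
    have e3 : |ε| * b * d ≤ M * h + 2 * M ^ 2 * (|ε| * ‖w‖) + M ^ 2 * |ε| * (|ε| * b) := by
      have a1 : φ (T x) = ε * φ (T₁ w) + ε * (β * φ (T₁ y)) + ε ^ 2 * φ (T₂ x) := by
        simp only [hT, LinearMap.add_apply, LinearMap.smul_apply, map_add, map_smul, hφ,
          smul_eq_mul, x]
        ring
      have a2 : |ε| * b * d = |ε * (β * φ (T₁ y))| := by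
        rw [hb, hd, abs_mul, abs_mul]
        field_simp
      have a3 : ε * (β * φ (T₁ y)) = φ (T x) - ε * φ (T₁ w) - ε ^ 2 * φ (T₂ x) := by
        rw [a1]; ring
      have a4 : |φ (T x)| ≤ M * h := h₃' _
      have a5 : |ε * φ (T₁ w)| ≤ |ε| * (M * (M * ‖w‖)) := by
        rw [abs_mul]
        gcongr
        exact (h₃' _).trans (by gcongr; exact h₁' w)
      have a6 : |ε ^ 2 * φ (T₂ x)| ≤ |ε| ^ 2 * (M * (M * (‖w‖ + b))) := by
        rw [abs_mul, abs_pow]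
        gcongr
        exact (h₃' _).trans (by gcongr; exact (h₂' x).trans (by gcongr))
      rw [a2, a3]
      have a7 := abs_sub (φ (T x) - ε * φ (T₁ w)) (ε ^ 2 * φ (T₂ x))
      have a8 := abs_sub (φ (T x)) (ε * φ (T₁ w))
      have a9 : |ε| ^ 2 * (M * (M * ‖w‖)) ≤ |ε| * (M * (M * ‖w‖)) := by
        gcongr
        exact pow_le_of_le_one h0 hε1 two_ne_zero
      linarith only [a4, a5, a6, a7, a8, a9]
    rw [div_mul_eq_mul_div, div_le_iff₀ hK0]
    have e7 : |ε| * ‖x‖ ≤ |ε| * (‖w‖ + b) := by gcongr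
    have e8 := mul_add_le_of_le hc hd0 hM0 h0 hε1 (norm_nonneg w) hb0 hh0 hK₁ hε2 hε3 e1 e3
    rw [hK]
    linarith
  rw [div_le_iff₀ hK0] at key
  linarith

end Perturbation

/-! ### Order of magnitude of the four modal contributions. -/

section Bounds

variable {N l a b d : ℕ}

/-- `G` has size `β` in the controllable modes and `β |ε|` in the uncontrollable ones. -/
structure InputBound {κ : Type*} [Fintype κ] [DecidableEq κ]
    (U : Matrix (Fin N) (ModeIndex l a b d) ℂ) (β ε : ℝ) (G : Matrix (Fin N) κ ℂ) : Prop where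
  co : ‖(blockCO U)ᵀ * G‖ ≤ β
  cu : ‖(blockCU U)ᵀ * G‖ ≤ β
  uo : ‖(blockUO U)ᵀ * G‖ ≤ β * |ε|
  uu : ‖(blockUU U)ᵀ * G‖ ≤ β * |ε|

/-- `F` has size `β` in the observable modes and `β |ε|` in the unobservable ones. -/
structure OutputBound {κ : Type*} [Fintype κ] [DecidableEq κ]
    (V : Matrix (Fin N) (ModeIndex l a b d) ℂ) (β ε : ℝ) (F : Matrix κ (Fin N) ℂ) : Prop where
  co : ‖F * blockCO V‖ ≤ β
  uo : ‖F * blockUO V‖ ≤ β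
  cu : ‖F * blockCU V‖ ≤ β * |ε|
  uu : ‖F * blockUU V‖ ≤ β * |ε|

variable {κ κ' κ'' : Type*} [Fintype κ] [DecidableEq κ] [Fintype κ'] [DecidableEq κ']
  [Fintype κ''] [DecidableEq κ'']

omit [DecidableEq κ] in
lemma norm_mul_le_of_le {M : Matrix κ κ' ℂ} {M' : Matrix κ' κ'' ℂ} {x y : ℝ} (h : ‖M‖ ≤ x)
    (h' : ‖M'‖ ≤ y) : ‖M * M'‖ ≤ x * y :=
  (Matrix.l2_opNorm_mul _ _).trans
    (mul_le_mul h h' (norm_nonneg _) ((norm_nonneg _).trans h))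

lemma InputBound.mul {U : Matrix (Fin N) (ModeIndex l a b d) ℂ} {β ε γ : ℝ}
    {G : Matrix (Fin N) κ ℂ} (h : InputBound U β ε G) {M : Matrix κ κ' ℂ} (hM : ‖M‖ ≤ γ) :
    InputBound U (β * γ) ε (G * M) where
  co := by rw [← Matrix.mul_assoc]; exact norm_mul_le_of_le h.co hM
  cu := by rw [← Matrix.mul_assoc]; exact norm_mul_le_of_le h.cu hM
  uo := by rw [← Matrix.mul_assoc, mul_right_comm]; exact norm_mul_le_of_le h.uo hM
  uu := by rw [← Matrix.mul_assoc, mul_right_comm]; exact norm_mul_le_of_le h.uu hM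

lemma OutputBound.mul {V : Matrix (Fin N) (ModeIndex l a b d) ℂ} {β ε γ : ℝ}
    {F : Matrix κ (Fin N) ℂ} (h : OutputBound V β ε F) {M : Matrix κ' κ ℂ} (hM : ‖M‖ ≤ γ) :
    OutputBound V (γ * β) ε (M * F) where
  co := by rw [Matrix.mul_assoc]; exact norm_mul_le_of_le hM h.co
  cu := by rw [Matrix.mul_assoc, mul_assoc]; exact norm_mul_le_of_le hM h.cu
  uo := by rw [Matrix.mul_assoc]; exact norm_mul_le_of_le hM h.uo
  uu := by rw [Matrix.mul_assoc, mul_assoc]; exact norm_mul_le_of_le hM h.uu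

lemma InputBound.mono {U : Matrix (Fin N) (ModeIndex l a b d) ℂ} {β β' ε : ℝ}
    {G : Matrix (Fin N) κ ℂ} (h : InputBound U β ε G) (hβ : β ≤ β') : InputBound U β' ε G where
  co := h.co.trans hβ
  cu := h.cu.trans hβ
  uo := h.uo.trans (by gcongr)
  uu := h.uu.trans (by gcongr)

lemma OutputBound.mono {V : Matrix (Fin N) (ModeIndex l a b d) ℂ} {β β' ε : ℝ}
    {F : Matrix κ (Fin N) ℂ} (h : OutputBound V β ε F) (hβ : β ≤ β') : OutputBound V β' ε F where
  co := h.co.trans hβ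
  cu := h.cu.trans (by gcongr)
  uo := h.uo.trans hβ
  uu := h.uu.trans (by gcongr)

omit [Fintype κ] [DecidableEq κ] [Fintype κ'] [DecidableEq κ'] in
/-- The splitting of a modal expansion into the four groups of modes. -/
lemma mul_diagonal_mul_eq_add (F : Matrix κ (Fin N) ℂ) (G : Matrix (Fin N) κ' ℂ)
    (V U : Matrix (Fin N) (ModeIndex l a b d) ℂ) (D : ModeIndex l a b d → ℂ) :
    F * (V * Matrix.diagonal D * Uᵀ) * G =
      (F * blockCO V) * Matrix.diagonal (fun j => D (Sum.inl j)) * ((blockCO U)ᵀ * G)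
      + (F * blockCU V) * Matrix.diagonal (fun j => D (Sum.inr (Sum.inl j))) *
        ((blockCU U)ᵀ * G)
      + (F * blockUO V) * Matrix.diagonal (fun j => D (Sum.inr (Sum.inr (Sum.inl j)))) *
        ((blockUO U)ᵀ * G)
      + (F * blockUU V) * Matrix.diagonal (fun j => D (Sum.inr (Sum.inr (Sum.inr j)))) *
        ((blockUU U)ᵀ * G) := by
  have h : V * Matrix.diagonal D * Uᵀ =
      blockCO V * Matrix.diagonal (fun j => D (Sum.inl j)) * (blockCO U)ᵀ
      + blockCU V * Matrix.diagonal (fun j => D (Sum.inr (Sum.inl j))) * (blockCU U)ᵀ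
      + blockUO V * Matrix.diagonal (fun j => D (Sum.inr (Sum.inr (Sum.inl j)))) * (blockUO U)ᵀ
      + blockUU V * Matrix.diagonal (fun j => D (Sum.inr (Sum.inr (Sum.inr j)))) *
        (blockUU U)ᵀ := by
    ext i j
    simp only [Matrix.add_apply]
    rw [Matrix.mul_apply, Matrix.mul_apply, Matrix.mul_apply, Matrix.mul_apply, Matrix.mul_apply]
    simp only [Matrix.mul_diagonal, Fintype.sum_sum_type,
      blockCO, blockCU, blockUO, blockUU, Matrix.submatrix_apply, Matrix.transpose_apply, id]
    ring
  rw [h]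
  simp only [Matrix.mul_add, Matrix.add_mul, Matrix.mul_assoc]

lemma norm_diagonal_le_one {D : κ → ℂ} (h : ∀ j, ‖D j‖ ≤ 1) :
    ‖(Matrix.diagonal D : Matrix κ κ ℂ)‖ ≤ 1 := by
  rw [Matrix.l2_opNorm_diagonal]
  exact (pi_norm_le_iff_of_nonneg zero_le_one).2 h

/-- Only the controllable and observable modes contribute at order zero. -/
lemma IsModalDecomposition.norm_sub_le {A : Matrix (Fin N) (Fin N) ℝ}
    {V U : Matrix (Fin N) (ModeIndex l a b d) ℂ} {Λ : ModeIndex l a b d → ℂ}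
    (h : IsModalDecomposition A V Λ U) (hΛ : ∀ j, ‖Λ j‖ ≤ 1) {β ε : ℝ} (hε : |ε| ≤ 1)
    {F : Matrix κ (Fin N) ℂ} {G : Matrix (Fin N) κ' ℂ} (hF : OutputBound V β ε F)
    (hG : InputBound U β ε G) (i : ℕ) :
    ‖F * toC A ^ i * G - (F * blockCO V) * Matrix.diagonal (fun j => Λ (Sum.inl j)) ^ i *
      ((blockCO U)ᵀ * G)‖ ≤ 3 * β ^ 2 * |ε| := by
  have hΛi : ∀ j, ‖(Λ ^ i) j‖ ≤ 1 := fun j => by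
    rw [Pi.pow_apply, norm_pow]
    exact pow_le_one₀ (norm_nonneg _) (hΛ j)
  have hβ : 0 ≤ β := (norm_nonneg _).trans hF.co
  rw [h.pow_eq, mul_diagonal_mul_eq_add, Matrix.diagonal_pow]
  have h1 := norm_mul_le_of_le (norm_mul_le_of_le hF.cu
    (norm_diagonal_le_one fun j => hΛi (Sum.inr (Sum.inl j)))) hG.cu
  have h2 := norm_mul_le_of_le (norm_mul_le_of_le hF.uo
    (norm_diagonal_le_one fun j => hΛi (Sum.inr (Sum.inr (Sum.inl j))))) hG.uo
  have h3 := norm_mul_le_of_le (norm_mul_le_of_le hF.uu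
    (norm_diagonal_le_one fun j => hΛi (Sum.inr (Sum.inr (Sum.inr j))))) hG.uu
  have hco : (fun j => (Λ ^ i) (Sum.inl j)) = (fun j => Λ (Sum.inl j)) ^ i := rfl
  rw [hco]
  have hsub : ∀ w x y z : Matrix κ κ' ℂ, w + x + y + z - w = x + y + z := fun w x y z => by abel
  rw [hsub]
  refine (norm_add₃_le).trans ((add_le_add (add_le_add h1 h2) h3).trans ?_)
  -- Two of the three remaining groups carry one factor `|ε|`; only the uncontrollable and
  -- unobservable one carries two.
  have : β * |ε| * (β * |ε|) ≤ β * β * |ε| := by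
    nlinarith [mul_nonneg (mul_nonneg hβ hβ) (mul_nonneg (abs_nonneg ε) (sub_nonneg.2 hε))]
  linarith

end Bounds

/-! ### Stability of Markov parameters under approximate similarity. -/

section Core

variable {l : ℕ} {κ κ' : Type*} [Fintype κ] [DecidableEq κ] [Fintype κ'] [DecidableEq κ']

lemma norm_one_le_one : ‖(1 : Matrix κ κ ℂ)‖ ≤ 1 := by
  rw [← Matrix.diagonal_one]
  exact norm_diagonal_le_one fun _ => by simp

/-- If `S T` is close to the identity, `T` has an inverse bounded by twice the norm of `S`. -/
lemma exists_inverse_of_norm_mul_sub_one_le {S T : Matrix κ κ ℂ} (h : ‖S * T - 1‖ ≤ 1 / 2) :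
    ∃ R : Matrix κ κ ℂ, T * R = 1 ∧ R * T = 1 ∧ ‖R‖ ≤ 2 * ‖S‖ := by
  have hu : IsUnit (S * T) := by
    have : IsUnit (1 - (1 - S * T)) := isUnit_one_sub_of_norm_lt_one (by
      rw [norm_sub_rev]; linarith)
    simpa using this
  have hT : IsUnit T.det := by
    have := (Matrix.isUnit_iff_isUnit_det _).1 hu
    rw [Matrix.det_mul] at this
    exact isUnit_of_mul_isUnit_right this
  refine ⟨T⁻¹, Matrix.mul_nonsing_inv _ hT, Matrix.nonsing_inv_mul _ hT, ?_⟩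
  have e : T⁻¹ = S - (S * T - 1) * T⁻¹ := by
    rw [Matrix.sub_mul, Matrix.mul_assoc, Matrix.mul_nonsing_inv _ hT]
    simp
  have h1 : ‖T⁻¹‖ ≤ ‖S‖ + 1 / 2 * ‖T⁻¹‖ := by
    conv_lhs => rw [e]
    refine (norm_sub_le _ _).trans ?_
    gcongr
    exact norm_mul_le_of_le h le_rfl
  linarith

/-- Powers of a small perturbation of a contraction, uniformly in the exponent. -/
lemma norm_pow_sub_pow_le {M D : Matrix κ κ ℂ} {ρ δ : ℝ} (hρ : ρ < 1) (hD : ‖D‖ ≤ ρ)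
    (hδ : ‖M - D‖ ≤ δ) (hδρ : δ ≤ (1 - ρ) / 2) (hDi : ∀ i : ℕ, ‖D ^ i‖ ≤ 1) (i : ℕ) :
    ‖M ^ i - D ^ i‖ ≤ 2 * δ / (1 - ρ) := by
  have hδ0 : 0 ≤ δ := (norm_nonneg _).trans hδ
  have h1 : 0 < 1 - ρ := by linarith
  have hM : ‖M‖ ≤ (1 + ρ) / 2 := by
    have : M = (M - D) + D := by abel
    rw [this]
    refine (norm_add_le _ _).trans ?_
    linarith
  induction i with
  | zero => simp; positivity
  | succ i ih =>
    -- The error satisfies `x ↦ (1 + ρ) / 2 * x + δ`, whose fixed point `2 δ / (1 - ρ)` bounds it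
    -- for every exponent.
    have e : M ^ (i + 1) - D ^ (i + 1) = M * (M ^ i - D ^ i) + (M - D) * D ^ i := by
      rw [pow_succ', pow_succ', mul_sub, sub_mul]
      abel
    rw [e]
    refine (norm_add_le _ _).trans ((add_le_add (norm_mul_le_of_le hM ih)
      (norm_mul_le_of_le hδ (hDi i))).trans ?_)
    have : (1 + ρ) / 2 * (2 * δ / (1 - ρ)) + δ * 1 = 2 * δ / (1 - ρ) := by
      field_simp
      ring
    exact this.le

omit [DecidableEq κ] in
/-- The Markov parameters of a reduced model whose coefficients are, up to `γ`, the compressions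
of the diagonal model `(D, b, c)` by `S` and `T` with `S T` close to the identity. -/
theorem norm_reduced_markov_sub_le {D : Fin l → ℂ} {ρ β : ℝ} (hρ : ρ < 1) (hρ0 : 0 ≤ ρ)
    (hD : ∀ j, ‖D j‖ ≤ ρ) (hβ : 0 ≤ β) :
    ∃ K γ₀ : ℝ, 0 ≤ K ∧ 0 < γ₀ ∧ ∀ γ ≤ γ₀, 0 ≤ γ →
      ∀ (S T A' : Matrix (Fin l) (Fin l) ℂ) (c C' : Matrix κ (Fin l) ℂ)
        (b B' : Matrix (Fin l) κ' ℂ),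
      ‖S‖ ≤ β → ‖T‖ ≤ β → ‖c‖ ≤ β → ‖b‖ ≤ β → ‖1 - S * T‖ ≤ γ →
      ‖A' - S * Matrix.diagonal D * T‖ ≤ γ → ‖C' - c * T‖ ≤ γ → ‖B' - S * b‖ ≤ γ →
      ∀ i : ℕ, ‖C' * A' ^ i * B' - c * Matrix.diagonal D ^ i * b‖ ≤ K * γ := by
  set Q := β + β + 2 * β * β * β with hQ
  have h1ρ : 0 < 1 - ρ := by linarith
  have hQ0 : 0 ≤ Q := by positivity
  refine ⟨2 * β * 2 * Q + β * (2 * (4 * β ^ 2) / (1 - ρ)) * Q + β * (β + 2 * β * β * β),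
    min (1 / 2) ((1 - ρ) / (2 * (4 * β ^ 2) + 1)), by positivity, by positivity, ?_⟩
  intro γ hγ hγ0 S T A' c C' b B' hS hT hc hb hST hA hC hB i
  have hγ1 : γ ≤ 1 / 2 := hγ.trans (min_le_left _ _)
  have hγ2 : 4 * β ^ 2 * γ ≤ (1 - ρ) / 2 := by
    have := hγ.trans (min_le_right _ _)
    rw [le_div_iff₀ (by positivity)] at this
    linarith
  obtain ⟨R, hTR, hRT, hR⟩ := exists_inverse_of_norm_mul_sub_one_le (S := S) (T := T)
    (by rw [norm_sub_rev]; exact hST.trans hγ1)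
  have hR' : ‖R‖ ≤ 2 * β := hR.trans (by linarith)
  set Δ : Matrix (Fin l) (Fin l) ℂ := Matrix.diagonal D
  have hΔ : ‖Δ‖ ≤ ρ := by
    rw [Matrix.l2_opNorm_diagonal]
    exact (pi_norm_le_iff_of_nonneg hρ0).2 hD
  have hΔi : ∀ i : ℕ, ‖Δ ^ i‖ ≤ 1 := fun i => by
    rw [Matrix.diagonal_pow]
    exact norm_diagonal_le_one fun j => by
      rw [Pi.pow_apply, norm_pow]
      exact pow_le_one₀ (norm_nonneg _) ((hD j).trans hρ.le)
  have hTS : ‖1 - T * S‖ ≤ 2 * β * β * γ := by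
    have e : 1 - T * S = T * (1 - S * T) * R := by
      rw [Matrix.mul_sub, Matrix.sub_mul, Matrix.mul_one, hTR]
      congr 1
      simp only [Matrix.mul_assoc, hTR, Matrix.mul_one]
    rw [e]
    refine (norm_mul_le_of_le (norm_mul_le_of_le hT hST) hR').trans (le_of_eq ?_)
    ring
  -- As `R` is the inverse of `T`, `M` is similar to `A'`; unlike `A'` it is close to the diagonal
  -- contraction itself.
  set M := T * A' * R with hM
  have hMi : ∀ i : ℕ, A' ^ i = R * M ^ i * T := by
    intro i
    induction i with
    | zero => simp [hRT]
    | succ i ih =>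
      rw [pow_succ, ih, pow_succ, hM]
      simp only [Matrix.mul_assoc, hRT, Matrix.mul_one]
  have hMΔ : ‖M - Δ‖ ≤ 4 * β ^ 2 * γ := by
    have e : M - Δ = T * (A' - S * Δ * T) * R - (1 - T * S) * Δ := by
      rw [hM, Matrix.mul_sub, Matrix.sub_mul, Matrix.sub_mul, Matrix.one_mul]
      have : T * (S * Δ * T) * R = T * S * Δ := by
        simp only [Matrix.mul_assoc, hTR, Matrix.mul_one]
      rw [this]
      abel
    rw [e]
    refine (norm_sub_le _ _).trans ((add_le_add
      (norm_mul_le_of_le (norm_mul_le_of_le hT hA) hR') (norm_mul_le_of_le hTS hΔ)).trans ?_)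
    have : 2 * β * β * γ * ρ ≤ 2 * β * β * γ * 1 := by gcongr
    linarith
  have hpow := norm_pow_sub_pow_le hρ hΔ hMΔ hγ2 hΔi i
  have hMn : ‖M ^ i‖ ≤ 2 := by
    have : M ^ i = (M ^ i - Δ ^ i) + Δ ^ i := by abel
    rw [this]
    refine (norm_add_le _ _).trans ?_
    have h2 : 2 * (4 * β ^ 2 * γ) / (1 - ρ) ≤ 1 := by
      rw [div_le_one h1ρ]; linarith
    linarith [hΔi i]
  have hP : ‖C' * R - c‖ ≤ 2 * β * γ := by
    have e : C' * R - c = (C' - c * T) * R := by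
      rw [Matrix.sub_mul, Matrix.mul_assoc, hTR, Matrix.mul_one]
    rw [e]
    exact (norm_mul_le_of_le hC hR').trans (le_of_eq (by ring))
  have hq : ‖T * B' - b‖ ≤ (β + 2 * β * β * β) * γ := by
    have e : T * B' - b = T * (B' - S * b) - (1 - T * S) * b := by
      rw [Matrix.mul_sub, Matrix.sub_mul, Matrix.one_mul, Matrix.mul_assoc]
      abel
    rw [e]
    refine (norm_sub_le _ _).trans ((add_le_add (norm_mul_le_of_le hT hB)
      (norm_mul_le_of_le hTS hb)).trans (le_of_eq (by ring)))
  have hqn : ‖T * B'‖ ≤ Q := by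
    have : T * B' = (T * B' - b) + b := by abel
    rw [this]
    refine (norm_add_le _ _).trans ((add_le_add hq hb).trans ?_)
    have : (β + 2 * β * β * β) * γ ≤ (β + 2 * β * β * β) * 1 := by gcongr; linarith
    linarith
  -- Output, power and input are replaced one at a time; the three terms give the three summands of
  -- the constant.
  have e : C' * A' ^ i * B' - c * Δ ^ i * b
      = (C' * R - c) * M ^ i * (T * B') + c * (M ^ i - Δ ^ i) * (T * B')
        + c * Δ ^ i * (T * B' - b) := by
    rw [hMi]
    simp only [Matrix.sub_mul, Matrix.mul_sub, Matrix.mul_assoc]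
    abel
  rw [e]
  refine (norm_add₃_le).trans ((add_le_add (add_le_add
    (norm_mul_le_of_le (norm_mul_le_of_le hP hMn) hqn)
    (norm_mul_le_of_le (norm_mul_le_of_le hc hpow) hqn))
    (norm_mul_le_of_le (norm_mul_le_of_le hc (hΔi i)) hq)).trans (le_of_eq ?_))
  ring

end Core

/-- The error of the Markov parameters of a Petrov–Galerkin projection `S T = 1`, uniformly in the
projection. -/
theorem IsModalDecomposition.exists_norm_markov_sub_le {N l a b d : ℕ} {κ κ' : Type*} [Fintype κ]
    [DecidableEq κ] [Fintype κ'] [DecidableEq κ'] {A : Matrix (Fin N) (Fin N) ℝ}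
    {V U : Matrix (Fin N) (ModeIndex l a b d) ℂ} {Λ : ModeIndex l a b d → ℂ}
    (h : IsModalDecomposition A V Λ U) (hΛ : ∀ j, ‖Λ j‖ < 1) {β : ℝ} (hβ : 0 ≤ β) :
    ∃ K ε₀ : ℝ, 0 ≤ K ∧ 0 < ε₀ ∧ ∀ ε : ℝ, |ε| < ε₀ →
      ∀ (C : Matrix κ (Fin N) ℂ) (B : Matrix (Fin N) κ' ℂ) (S : Matrix (Fin l) (Fin N) ℂ)
        (T : Matrix (Fin N) (Fin l) ℂ), OutputBound V β ε C → InputBound U β ε B →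
      OutputBound V β ε S → InputBound U β ε T → S * T = 1 →
      ∀ i : ℕ, ‖C * T * (S * toC A * T) ^ i * (S * B) - C * toC A ^ i * B‖ ≤ K * |ε| := by
  obtain ⟨ρ, hρ0, hρ, hD⟩ : ∃ ρ : ℝ, 0 ≤ ρ ∧ ρ < 1 ∧ ∀ j : Fin l, ‖Λ (Sum.inl j)‖ ≤ ρ :=
    ⟨‖fun j : Fin l => Λ (Sum.inl j)‖, norm_nonneg _,
      (pi_norm_lt_iff zero_lt_one).2 fun j => hΛ _, fun j => norm_le_pi_norm
        (fun j : Fin l => Λ (Sum.inl j)) j⟩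
  obtain ⟨K, γ₀, hK, hγ₀, hmain⟩ := norm_reduced_markov_sub_le (κ := κ) (κ' := κ') hρ hρ0 hD hβ
  refine ⟨(K + 1) * (3 * β ^ 2), min 1 (γ₀ / (3 * β ^ 2 + 1)), by positivity, by positivity, ?_⟩
  intro ε hε C B S T hC hB hS hT hST i
  have hε1 : |ε| ≤ 1 := (hε.trans_le (min_le_left _ _)).le
  have hε2 : 3 * β ^ 2 * |ε| ≤ γ₀ := by
    have := hε.trans_le (min_le_right _ _)
    rw [lt_div_iff₀ (by positivity)] at this
    nlinarith [abs_nonneg ε]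
  have hΛ' : ∀ j, ‖Λ j‖ ≤ 1 := fun j => (hΛ j).le
  -- One estimate serves all five products: exponent `0` for `S T`, `C T`, `S B`, exponent `1` for
  -- `S A T`, exponent `i` for the true Markov parameter.
  have e1 := h.norm_sub_le hΛ' hε1 hS hT 0
  have e2 := h.norm_sub_le hΛ' hε1 hS hT 1
  have e3 := h.norm_sub_le hΛ' hε1 hC hT 0
  have e4 := h.norm_sub_le hΛ' hε1 hS hB 0
  have e5 := h.norm_sub_le hΛ' hε1 hC hB i
  simp only [pow_zero, pow_one, Matrix.mul_one] at e1 e2 e3 e4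
  rw [hST] at e1
  have := hmain _ hε2 (by positivity) _ _ _ _ _ _ _ hS.co hT.co hC.co hB.co e1 e2 e3 e4 i
  have h2 := norm_sub_le_norm_sub_add_norm_sub (C * T * (S * toC A * T) ^ i * (S * B))
    ((C * blockCO V) * Matrix.diagonal (fun j => Λ (Sum.inl j)) ^ i * ((blockCO U)ᵀ * B))
    (C * toC A ^ i * B)
  rw [norm_sub_rev (C * blockCO V * _ * _) (C * toC A ^ i * B)] at h2
  linarith

/-! ### Dependence of snapshots and of `Zᵀ X` on `ε`. -/

section WeakFamilies

variable {N l a b d : ℕ} {κ : Type*} [Fintype κ] [DecidableEq κ]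

/-- A family of matrices whose controllable modal blocks are constant and whose uncontrollable
ones are proportional to `ε`. -/
structure IsWeakInput (U : Matrix (Fin N) (ModeIndex l a b d) ℂ)
    (G : ℝ → Matrix (Fin N) κ ℂ) : Prop where
  co : ∃ M, ∀ ε, (blockCO U)ᵀ * G ε = M
  cu : ∃ M, ∀ ε, (blockCU U)ᵀ * G ε = M
  uo : ∃ M, ∀ ε, (blockUO U)ᵀ * G ε = (ε : ℂ) • M
  uu : ∃ M, ∀ ε, (blockUU U)ᵀ * G ε = (ε : ℂ) • M

/-- A family of matrices whose observable modal blocks are constant and whose unobservable ones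
are proportional to `ε`. -/
structure IsWeakOutput (V : Matrix (Fin N) (ModeIndex l a b d) ℂ)
    (F : ℝ → Matrix κ (Fin N) ℂ) : Prop where
  co : ∃ M, ∀ ε, F ε * blockCO V = M
  uo : ∃ M, ∀ ε, F ε * blockUO V = M
  cu : ∃ M, ∀ ε, F ε * blockCU V = (ε : ℂ) • M
  uu : ∃ M, ∀ ε, F ε * blockUU V = (ε : ℂ) • M

omit [DecidableEq κ] in
lemma norm_ofReal_smul_le {κ' : Type*} [Fintype κ'] [DecidableEq κ'] (M : Matrix κ κ' ℂ)
    {β ε : ℝ} (h : ‖M‖ ≤ β) : ‖(ε : ℂ) • M‖ ≤ β * |ε| := by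
  rw [norm_smul, Complex.norm_real, Real.norm_eq_abs, mul_comm]
  gcongr

lemma IsWeakInput.exists_bound {U : Matrix (Fin N) (ModeIndex l a b d) ℂ}
    {G : ℝ → Matrix (Fin N) κ ℂ} (h : IsWeakInput U G) :
    ∃ β, 0 ≤ β ∧ ∀ ε, InputBound U β ε (G ε) := by
  obtain ⟨⟨M₁, h₁⟩, ⟨M₂, h₂⟩, ⟨M₃, h₃⟩, ⟨M₄, h₄⟩⟩ := h
  have n₁ := norm_nonneg M₁
  have n₂ := norm_nonneg M₂
  have n₃ := norm_nonneg M₃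
  have n₄ := norm_nonneg M₄
  refine ⟨‖M₁‖ + ‖M₂‖ + ‖M₃‖ + ‖M₄‖, by positivity, fun ε => ⟨?_, ?_, ?_, ?_⟩⟩
  · rw [h₁]; linarith
  · rw [h₂]; linarith
  · rw [h₃]; exact norm_ofReal_smul_le _ (by linarith)
  · rw [h₄]; exact norm_ofReal_smul_le _ (by linarith)

lemma IsWeakOutput.exists_bound {V : Matrix (Fin N) (ModeIndex l a b d) ℂ}
    {F : ℝ → Matrix κ (Fin N) ℂ} (h : IsWeakOutput V F) :
    ∃ β, 0 ≤ β ∧ ∀ ε, OutputBound V β ε (F ε) := by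
  obtain ⟨⟨M₁, h₁⟩, ⟨M₂, h₂⟩, ⟨M₃, h₃⟩, ⟨M₄, h₄⟩⟩ := h
  have n₁ := norm_nonneg M₁
  have n₂ := norm_nonneg M₂
  have n₃ := norm_nonneg M₃
  have n₄ := norm_nonneg M₄
  refine ⟨‖M₁‖ + ‖M₂‖ + ‖M₃‖ + ‖M₄‖, by positivity, fun ε => ⟨?_, ?_, ?_, ?_⟩⟩
  · rw [h₁]; linarith
  · rw [h₂]; linarith
  · rw [h₃]; exact norm_ofReal_smul_le _ (by linarith)
  · rw [h₄]; exact norm_ofReal_smul_le _ (by linarith)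

variable {p q m n : ℕ} {A : Matrix (Fin N) (Fin N) ℝ}
  {V U : Matrix (Fin N) (ModeIndex l a b d) ℂ} {Λ : ModeIndex l a b d → ℂ}
  {B : ℝ → Matrix (Fin N) (Fin p) ℝ} {C : ℝ → Matrix (Fin q) (Fin N) ℝ}

lemma IsWeaklyCoupled.isWeakInput (h : IsWeaklyCoupled V U B C) :
    IsWeakInput U fun ε => toC (B ε) :=
  ⟨h.input_co, h.input_cu, h.input_uo, h.input_uu⟩

lemma IsWeaklyCoupled.isWeakOutput (h : IsWeaklyCoupled V U B C) :
    IsWeakOutput V fun ε => toC (C ε) :=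
  ⟨h.output_co, h.output_uo, h.output_cu, h.output_uu⟩

lemma IsWeaklyCoupled.isWeakInput_primalSnapshots (hw : IsWeaklyCoupled V U B C)
    (h : IsModalDecomposition A V Λ U) (u : ℕ → Fin p → ℝ) (t : Fin m → ℕ) :
    IsWeakInput U fun ε => toC (primalSnapshots A (B ε) u t) := by
  obtain ⟨⟨M₁, h₁⟩, ⟨M₂, h₂⟩, ⟨M₃, h₃⟩, ⟨M₄, h₄⟩⟩ := hw.isWeakInput
  refine ⟨⟨modalSnapshots (Λ ∘ Sum.inl) M₁ u t, fun ε => ?_⟩,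
    ⟨modalSnapshots (Λ ∘ (fun i => Sum.inr (Sum.inl i))) M₂ u t, fun ε => ?_⟩,
    ⟨modalSnapshots (Λ ∘ (fun i => Sum.inr (Sum.inr (Sum.inl i)))) M₃ u t, fun ε => ?_⟩,
    ⟨modalSnapshots (Λ ∘ (fun i => Sum.inr (Sum.inr (Sum.inr i)))) M₄ u t, fun ε => ?_⟩⟩
  · rw [← h₁ ε]; exact h.transpose_submatrix_mul_snapshots _ _ u t
  · rw [← h₂ ε]; exact h.transpose_submatrix_mul_snapshots _ _ u t
  · rw [← modalSnapshots_smul, ← h₃ ε]; exact h.transpose_submatrix_mul_snapshots _ _ u t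
  · rw [← modalSnapshots_smul, ← h₄ ε]; exact h.transpose_submatrix_mul_snapshots _ _ u t

lemma IsModalDecomposition.toC_transpose_adjointSnapshots_mul (h : IsModalDecomposition A V Λ U)
    {κ' : Type*} [Fintype κ'] [DecidableEq κ'] (f : κ' → ModeIndex l a b d)
    (C : Matrix (Fin q) (Fin N) ℝ) (v : ℕ → Fin q → ℝ) (s : Fin n → ℕ) :
    toC (adjointSnapshots A C v s)ᵀ * V.submatrix id f
      = (modalSnapshots (Λ ∘ f) (toC C * V.submatrix id f)ᵀ v s)ᵀ := by
  have := h.transpose.transpose_submatrix_mul_snapshots f Cᵀ v s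
  rw [← Matrix.transpose_transpose (toC (adjointSnapshots A C v s)ᵀ * V.submatrix id f),
    Matrix.transpose_mul, Matrix.transpose_mul (toC C)]
  exact congrArg Matrix.transpose this

lemma IsWeaklyCoupled.isWeakOutput_adjointSnapshots (hw : IsWeaklyCoupled V U B C)
    (h : IsModalDecomposition A V Λ U) (v : ℕ → Fin q → ℝ) (s : Fin n → ℕ) :
    IsWeakOutput V fun ε => toC (adjointSnapshots A (C ε) v s)ᵀ := by
  obtain ⟨⟨M₁, h₁⟩, ⟨M₂, h₂⟩, ⟨M₃, h₃⟩, ⟨M₄, h₄⟩⟩ := hw.isWeakOutput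
  refine ⟨⟨(modalSnapshots (Λ ∘ Sum.inl) M₁ᵀ v s)ᵀ, fun ε => ?_⟩,
    ⟨(modalSnapshots (Λ ∘ (fun i => Sum.inr (Sum.inr (Sum.inl i)))) M₂ᵀ v s)ᵀ, fun ε => ?_⟩,
    ⟨(modalSnapshots (Λ ∘ (fun i => Sum.inr (Sum.inl i))) M₃ᵀ v s)ᵀ, fun ε => ?_⟩,
    ⟨(modalSnapshots (Λ ∘ (fun i => Sum.inr (Sum.inr (Sum.inr i)))) M₄ᵀ v s)ᵀ, fun ε => ?_⟩⟩
  · rw [← h₁ ε]; exact h.toC_transpose_adjointSnapshots_mul _ _ v s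
  · rw [← h₂ ε]; exact h.toC_transpose_adjointSnapshots_mul _ _ v s
  · rw [← Matrix.transpose_smul, ← modalSnapshots_smul, ← Matrix.transpose_smul, ← h₃ ε]
    exact h.toC_transpose_adjointSnapshots_mul _ _ v s
  · rw [← Matrix.transpose_smul, ← modalSnapshots_smul, ← Matrix.transpose_smul, ← h₄ ε]
    exact h.toC_transpose_adjointSnapshots_mul _ _ v s

/-- The product of weakly coupled families is quadratic in `ε`, and at order zero it factors
through the controllable and observable modes. -/
lemma IsModalDecomposition.exists_mul_eq_quadratic (h : IsModalDecomposition A V Λ U)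
    {X : ℝ → Matrix (Fin N) (Fin m) ℝ} {Z : ℝ → Matrix (Fin N) (Fin n) ℝ}
    (hX : IsWeakInput U fun ε => toC (X ε)) (hZ : IsWeakOutput V fun ε => toC (Z ε)ᵀ) :
    (∃ E₁ E₂ : Matrix (Fin n) (Fin m) ℝ, ∀ η : ℝ,
      (Z η)ᵀ * X η = (Z 0)ᵀ * X 0 + η • E₁ + η ^ 2 • E₂) ∧
    toC ((Z 0)ᵀ * X 0) = (toC (Z 0)ᵀ * blockCO V) * ((blockCO U)ᵀ * toC (X 0)) := by
  obtain ⟨⟨X₁, hX₁⟩, ⟨X₂, hX₂⟩, ⟨X₃, hX₃⟩, ⟨X₄, hX₄⟩⟩ := hX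
  obtain ⟨⟨Z₁, hZ₁⟩, ⟨Z₂, hZ₂⟩, ⟨Z₃, hZ₃⟩, ⟨Z₄, hZ₄⟩⟩ := hZ
  have key : ∀ η : ℝ, toC ((Z η)ᵀ * X η) = Z₁ * X₁ + (η : ℂ) • (Z₃ * X₂ + Z₂ * X₃)
      + ((η ^ 2 : ℝ) : ℂ) • (Z₄ * X₄) := by
    intro η
    have e := mul_diagonal_mul_eq_add (toC (Z η)ᵀ) (toC (X η)) V U 1
    have h1 : V * (Matrix.diagonal 1 : Matrix (ModeIndex l a b d) (ModeIndex l a b d) ℂ) * Uᵀ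
        = (1 : Matrix (Fin N) (Fin N) ℂ) := by
      rw [← h.right_inv, show (Matrix.diagonal 1 : Matrix (ModeIndex l a b d) _ ℂ) = 1 from
        Matrix.diagonal_one, Matrix.mul_one]
    rw [h1, Matrix.mul_one, ← toC_mul, hX₁, hX₂, hX₃, hX₄, hZ₁, hZ₂, hZ₃, hZ₄] at e
    simp only [Pi.one_apply, Matrix.diagonal_one, Matrix.mul_one, Matrix.smul_mul,
      Matrix.mul_smul] at e
    rw [e, smul_smul, smul_add, pow_two, Complex.ofReal_mul]
    abel
  have h0 : toC ((Z 0)ᵀ * X 0) = Z₁ * X₁ := by simpa using key 0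
  -- The modal blocks are complex, but the product is real, so taking real parts of the coefficients
  -- keeps the identity.
  refine ⟨⟨(Z₃ * X₂ + Z₂ * X₃).map Complex.re, (Z₄ * X₄).map Complex.re, fun η => ?_⟩, ?_⟩
  · ext i j
    have e := congrArg Complex.re (congrFun (congrFun (key η) i) j)
    rw [← h0] at e
    simpa only [Matrix.add_apply, Matrix.smul_apply, Matrix.map_apply, Complex.add_re, smul_eq_mul,
      Complex.re_ofReal_mul, Complex.ofReal_re] using e
  · rw [h0, hX₁, hZ₁]

lemma firstOrderTerm_eq {H : ℝ → Matrix (Fin n) (Fin m) ℝ} {E₁ E₂ : Matrix (Fin n) (Fin m) ℝ}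
    (h : ∀ η : ℝ, H η = H 0 + η • E₁ + η ^ 2 • E₂) : firstOrderTerm H = E₁ := by
  ext i j
  have hd : HasDerivAt (fun η : ℝ => H 0 i j + η * E₁ i j + η ^ 2 * E₂ i j) (E₁ i j) 0 := by
    have h1 := (((hasDerivAt_id (0 : ℝ)).mul_const (E₁ i j)).const_add (H 0 i j)).add
      (((hasDerivAt_id (0 : ℝ)).pow 2).mul_const (E₂ i j))
    refine (h1.congr_deriv (by simp)).congr_of_eventuallyEq (Filter.Eventually.of_forall ?_)
    intro η
    simp
  rw [firstOrderTerm, Matrix.of_apply, ← hd.deriv]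
  congr 1
  funext η
  rw [h η]
  simp

end WeakFamilies

/-! ### Rank of the zeroth-order matrix. -/

section Rank

variable {l m n : ℕ}

/-- The factors are complex while the rank is real, so the proof goes through real minors. The first
`l` rows have the kernel of `H`, because the corresponding rows of `Z` are injective, and they
contain an invertible `l × l` minor. -/
lemma rank_eq_of_factorization {H : Matrix (Fin n) (Fin m) ℝ} {Z : Matrix (Fin n) (Fin l) ℂ}
    {X : Matrix (Fin l) (Fin m) ℂ} (h : toC H = Z * X) (hm : l ≤ m) (hn : l ≤ n)
    (hZ : (Z.submatrix (Fin.castLE hn) id).det ≠ 0)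
    (hX : (X.submatrix id (Fin.castLE hm)).det ≠ 0) : H.rank = l := by
  set H₁ := H.submatrix (Fin.castLE hn) id with hH₁
  have hker : LinearMap.ker H.mulVecLin = LinearMap.ker H₁.mulVecLin := by
    ext x
    simp only [LinearMap.mem_ker, Matrix.mulVecLin_apply]
    have hval : ∀ i, ((H *ᵥ x) i : ℂ) = (Z *ᵥ (X *ᵥ fun j => (x j : ℂ))) i := by
      intro i
      rw [Matrix.mulVec_mulVec, ← h]
      simp [Matrix.mulVec, dotProduct]
    refine ⟨fun hx => ?_, fun hx => ?_⟩
    · funext i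
      exact congrFun hx (Fin.castLE hn i)
    · have h1 : (Z.submatrix (Fin.castLE hn) id) *ᵥ (X *ᵥ fun j => (x j : ℂ)) = 0 := by
        funext i
        refine (hval (Fin.castLE hn i)).symm.trans ?_
        have : (H *ᵥ x) (Fin.castLE hn i) = 0 := congrFun hx i
        rw [this]
        simp
      have h2 := Matrix.eq_zero_of_mulVec_eq_zero hZ h1
      funext i
      have := hval i
      rw [h2, Matrix.mulVec_zero, Pi.zero_apply] at this
      exact_mod_cast this
  have hdet : (H₁.submatrix id (Fin.castLE hm)).det ≠ 0 := by
    have e : toC (H₁.submatrix id (Fin.castLE hm))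
        = Z.submatrix (Fin.castLE hn) id * X.submatrix id (Fin.castLE hm) := by
      ext i j
      have := congrFun (congrFun h (Fin.castLE hn i)) (Fin.castLE hm j)
      simpa [H₁, Matrix.mul_apply] using this
    have e2 := congrArg Matrix.det e
    rw [Matrix.det_mul] at e2
    have e3 : (toC (H₁.submatrix id (Fin.castLE hm))).det
        = ((H₁.submatrix id (Fin.castLE hm)).det : ℂ) :=
      (RingHom.map_det Complex.ofRealHom _).symm
    rw [e3] at e2
    intro h0
    rw [h0, Complex.ofReal_zero] at e2
    exact mul_ne_zero hZ hX e2.symm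
  have hrank₁ : H₁.rank = l := by
    refine le_antisymm (H₁.rank_le_height) ?_
    have := (H₁.submatrix id (Fin.castLE hm)).rank_of_isUnit
      ((Matrix.isUnit_iff_isUnit_det _).2 hdet.isUnit)
    rw [Fintype.card_fin] at this
    refine this.ge.trans ?_
    have e : H₁.submatrix id (Fin.castLE hm)
        = H₁ * (1 : Matrix (Fin m) (Fin m) ℝ).submatrix id (Fin.castLE hm) := by
      ext i j
      simp [Matrix.mul_apply, Matrix.one_apply]
    rw [e]
    exact Matrix.rank_mul_le_left _ _
  have r1 := LinearMap.finrank_range_add_finrank_ker H.mulVecLin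
  have r2 := LinearMap.finrank_range_add_finrank_ker H₁.mulVecLin
  rw [← hker] at r2
  have : H.rank = H₁.rank := by
    unfold Matrix.rank
    omega
  rw [this, hrank₁]

end Rank

/-! ### Singular value bounds for the family `H ε`. -/

section Hankel

open Module

variable {l m n : ℕ}

lemma exists_mul_norm_le_of_mem_orthogonal_ker {E F : Type*} [NormedAddCommGroup E]
    [InnerProductSpace ℝ E] [FiniteDimensional ℝ E] [NormedAddCommGroup F] [InnerProductSpace ℝ F]
    (T : E →ₗ[ℝ] F) : ∃ c, 0 < c ∧ ∀ x ∈ (LinearMap.ker T)ᗮ, c * ‖x‖ ≤ ‖T x‖ := by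
  have hker : LinearMap.ker (T.domRestrict (LinearMap.ker T)ᗮ) = ⊥ := by
    refine LinearMap.ker_eq_bot'.2 fun x hx => ?_
    have h1 : (x : E) ∈ LinearMap.ker T := hx
    exact Subtype.ext (inner_self_eq_zero.1 ((Submodule.mem_orthogonal _ _).1 x.2 _ h1))
  obtain ⟨K, hK, hanti⟩ := (T.domRestrict (LinearMap.ker T)ᗮ).exists_antilipschitzWith hker
  have hK' : (0 : ℝ) < K := hK
  refine ⟨(K : ℝ)⁻¹, inv_pos.2 hK', fun x hx => ?_⟩
  have := hanti.le_mul_norm (map_zero _) (⟨x, hx⟩ : (LinearMap.ker T)ᗮ)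
  rw [inv_mul_le_iff₀ hK']
  exact this

/-- The singular values of a quadratic family of matrices of rank `l` at `0`. -/
theorem exists_singularValue_bounds {H : ℝ → Matrix (Fin n) (Fin m) ℝ}
    {E₁ E₂ : Matrix (Fin n) (Fin m) ℝ} (h : ∀ η : ℝ, H η = H 0 + η • E₁ + η ^ 2 • E₂)
    (hrank : (H 0).rank = l) :
    ∃ c K ε₀ : ℝ, 0 < c ∧ 0 ≤ K ∧ 0 < ε₀ ∧ ∀ ε : ℝ, |ε| < ε₀ →
      (∀ k < l, c ≤ singularValue (H ε) k) ∧ singularValue (H ε) l ≤ K * |ε| ∧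
      (FirstOrderNonzero H → |ε| ≤ K * singularValue (H ε) l) := by
  set T₀ := Matrix.toEuclideanLin (H 0) with hT₀
  set T₁ := Matrix.toEuclideanLin E₁ with hT₁
  set T₂ := Matrix.toEuclideanLin E₂
  have hT : ∀ ε : ℝ, Matrix.toEuclideanLin (H ε) = T₀ + ε • T₁ + ε ^ 2 • T₂ := by
    intro ε
    rw [h ε, map_add, map_add, map_smul, map_smul]
  have hfr : finrank ℝ (LinearMap.range T₀) = l := by
    rw [← hrank, Matrix.rank_eq_finrank_range_toLin (H 0) (EuclideanSpace.basisFun _ ℝ).toBasis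
      (EuclideanSpace.basisFun _ ℝ).toBasis, hT₀, Matrix.toEuclideanLin_eq_toLin_orthonormal]
  have hadd := LinearMap.finrank_range_add_finrank_ker T₀
  have hadd' := Submodule.finrank_add_finrank_orthogonal (LinearMap.ker T₀)
  obtain ⟨c, hc, hbelow⟩ := exists_mul_norm_le_of_mem_orthogonal_ker T₀
  obtain ⟨K, ε₀, hK, hε₀, hmain⟩ := singularValues_perturbation T₀ T₁ T₂ l (LinearMap.ker T₀)ᗮ
    (LinearMap.ker T₀) (by omega) hc hbelow (by omega) (fun x hx => hx)
  -- The constants of the lower bound depend on the witnesses `x` and `y`, so they are fixed after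
  -- this case distinction.
  by_cases hF : FirstOrderNonzero H
  · obtain ⟨x, y, hx, hy, hxy⟩ := hF
    rw [firstOrderTerm_eq h] at hxy
    let φ : EuclideanSpace ℝ (Fin n) →ₗ[ℝ] ℝ :=
      { toFun := fun z => x ⬝ᵥ z.ofLp
        map_add' := fun z z' => by simp
        map_smul' := fun r z => by simp }
    obtain ⟨K', ε₀', hK', hε₀', hmain'⟩ := abs_le_mul_singularValues T₀ T₁ T₂ l
      (LinearMap.ker T₀)ᗮ (by omega) hc hbelow φ (WithLp.toLp 2 y)
      (fun z => by
        change x ⬝ᵥ (H 0 *ᵥ z.ofLp) = 0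
        rw [Matrix.dotProduct_mulVec, hx, zero_dotProduct])
      (by
        change WithLp.toLp 2 (H 0 *ᵥ y) = 0
        rw [hy]
        rfl)
      hxy
    refine ⟨c / 2, max K K', min ε₀ ε₀', by positivity, le_max_of_le_left hK, by positivity,
      fun ε hε => ?_⟩
    have h1 := hmain ε (hε.trans_le (min_le_left _ _))
    have h2 := hmain' ε (hε.trans_le (min_le_right _ _))
    simp only [singularValue, hT]
    refine ⟨h1.1, h1.2.trans ?_, fun _ => h2.trans ?_⟩
    · gcongr; exact le_max_left _ _
    · have := (T₀ + ε • T₁ + ε ^ 2 • T₂).singularValues_nonneg l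
      gcongr; exact le_max_right _ _
  · refine ⟨c / 2, K, ε₀, by positivity, hK, hε₀, fun ε hε => ?_⟩
    have h1 := hmain ε hε
    simp only [singularValue, hT]
    exact ⟨h1.1, h1.2, fun h => absurd h hF⟩

end Hankel

/-! ### Reduced-order models as bounded projections. -/

section ROM

variable {N p q l m n : ℕ}

lemma norm_firstCols_le_one {k : ℕ} (h : l ≤ k) {R : Matrix (Fin k) (Fin k) ℝ}
    (hR : R ∈ Matrix.orthogonalGroup (Fin k) ℝ) : ‖toC (firstCols h R)‖ ≤ 1 := by
  have e : (toC (firstCols h R))ᴴ * toC (firstCols h R) = 1 := by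
    have h1 : (firstCols h R)ᵀ * firstCols h R = 1 := by
      have h2 : Rᵀ * R = 1 := (Matrix.mem_orthogonalGroup_iff' _ _).1 hR
      ext i j
      have := congrFun (congrFun h2 (Fin.castLE h i)) (Fin.castLE h j)
      simpa [firstCols, Matrix.mul_apply, Matrix.one_apply] using this
    have h3 : (toC (firstCols h R))ᴴ = toC (firstCols h R)ᵀ := by
      ext i j
      simp
    rw [h3, ← toC_mul, h1]
    exact Matrix.map_one _ Complex.ofReal_zero Complex.ofReal_one
  have h4 := Matrix.l2_opNorm_conjTranspose_mul_self (toC (firstCols h R))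
  rw [e] at h4
  have h5 := norm_one_le_one (κ := Fin l)
  nlinarith [norm_nonneg (toC (firstCols h R))]

lemma norm_toC_invSqrtSigma_le {H : Matrix (Fin n) (Fin m) ℝ} {c : ℝ} (hc : 0 < c)
    (hσ : ∀ i < l, c ≤ singularValue H i) : ‖toC (invSqrtSigma l H)‖ ≤ (√c)⁻¹ := by
  have : toC (invSqrtSigma l H)
      = Matrix.diagonal fun i : Fin l => (((√(singularValue H i))⁻¹ : ℝ) : ℂ) :=
    Matrix.diagonal_map Complex.ofReal_zero
  rw [this, Matrix.l2_opNorm_diagonal]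
  refine (pi_norm_le_iff_of_nonneg (by positivity)).2 fun i => ?_
  rw [Complex.norm_real, Real.norm_of_nonneg (by positivity)]
  have := hσ i i.2
  gcongr

lemma IsSVD.firstCols_transpose_mul_mul {H : Matrix (Fin n) (Fin m) ℝ}
    {L : Matrix (Fin n) (Fin n) ℝ} {R : Matrix (Fin m) (Fin m) ℝ} (h : IsSVD H L R) (hm : l ≤ m)
    (hn : l ≤ n) : (firstCols hn L)ᵀ * H * firstCols hm R
      = Matrix.diagonal fun i : Fin l => singularValue H i := by
  set D : Matrix (Fin n) (Fin m) ℝ := Matrix.of fun (i : Fin n) (j : Fin m) =>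
    if (i : ℕ) = (j : ℕ) then singularValue H i else 0 with hD
  have hL : Lᵀ * L = 1 := (Matrix.mem_orthogonalGroup_iff' _ _).1 h.left_mem
  have hR : Rᵀ * R = 1 := (Matrix.mem_orthogonalGroup_iff' _ _).1 h.right_mem
  have h1 : Lᵀ * H * R = D := by
    have : Lᵀ * H * R = (Lᵀ * L) * D * (Rᵀ * R) := by
      conv_lhs => rw [h.eq]
      simp only [Matrix.mul_assoc, hD]
    rw [this, hL, hR, Matrix.one_mul, Matrix.mul_one]
  have h2 : (firstCols hn L)ᵀ * H * firstCols hm R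
      = (Lᵀ * H * R).submatrix (Fin.castLE hn) (Fin.castLE hm) := by
    ext i j
    simp [firstCols, Matrix.mul_apply]
  rw [h2, h1]
  ext i j
  simp only [hD, Matrix.submatrix_apply, Matrix.of_apply, Matrix.diagonal_apply, Fin.val_castLE,
    Fin.ext_iff]

/-- A reduced-order model is a Petrov–Galerkin projection, by matrices that are controlled by the
smallest singular value retained. -/
lemma IsROM.exists_projection {hm : l ≤ m} {hn : l ≤ n} {A : Matrix (Fin N) (Fin N) ℝ}
    {B : Matrix (Fin N) (Fin p) ℝ} {C : Matrix (Fin q) (Fin N) ℝ} {X : Matrix (Fin N) (Fin m) ℝ}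
    {Z : Matrix (Fin N) (Fin n) ℝ} {Ar : Matrix (Fin l) (Fin l) ℂ} {Br : Matrix (Fin l) (Fin p) ℂ}
    {Cr : Matrix (Fin q) (Fin l) ℂ} (h : IsROM hm hn A B C X Z Ar Br Cr) {c : ℝ} (hc : 0 < c)
    (hσ : ∀ i < l, c ≤ singularValue (Zᵀ * X) i) :
    ∃ (M : Matrix (Fin m) (Fin l) ℂ) (M' : Matrix (Fin l) (Fin n) ℂ), ‖M‖ ≤ (√c)⁻¹ ∧
      ‖M'‖ ≤ (√c)⁻¹ ∧ (M' * toC Zᵀ) * (toC X * M) = 1 ∧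
      ∀ i : ℕ, Cr * Ar ^ i * Br = toC C * (toC X * M) *
        ((M' * toC Zᵀ) * toC A * (toC X * M)) ^ i * ((M' * toC Zᵀ) * toC B) := by
  obtain ⟨L, R, T, S, P, Λr, Φ, Ψ, hsvd, hpos, hT, hS, hP, -, hΦ, hΨ, hAr, hBr, hCr⟩ := h
  set Q := invSqrtSigma l (Zᵀ * X) with hQ
  have hQn : ‖toC Q‖ ≤ (√c)⁻¹ := norm_toC_invSqrtSigma_le hc hσ
  -- The product collapses to `Σ_r^{-1/2} Σ_r Σ_r^{-1/2}`.
  have hST : S * T = 1 := by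
    have : S * T = Q * ((firstCols hn L)ᵀ * (Zᵀ * X) * firstCols hm R) * Q := by
      rw [hS, hT]
      simp only [Matrix.mul_assoc]
    rw [this, hsvd.firstCols_transpose_mul_mul hm hn, hQ, invSqrtSigma,
      Matrix.diagonal_mul_diagonal, Matrix.diagonal_mul_diagonal, ← Matrix.diagonal_one]
    congr 1
    funext i
    have hi := hpos i i.2
    have h2 := Real.mul_self_sqrt hi.le
    have h3 := (Real.sqrt_pos.2 hi).ne'
    field_simp
    nlinarith
  have hTc : toC T = toC X * (toC (firstCols hm R) * toC Q) := by
    rw [hT, toC_mul, toC_mul, Matrix.mul_assoc]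
  have hSc : toC S = toC Q * toC (firstCols hn L)ᵀ * toC Zᵀ := by
    rw [hS, toC_mul, toC_mul]
  have hLn : ‖toC (firstCols hn L)ᵀ‖ ≤ 1 := by
    have : toC (firstCols hn L)ᵀ = (toC (firstCols hn L))ᴴ := by
      ext i j
      simp
    rw [this, Matrix.l2_opNorm_conjTranspose]
    exact norm_firstCols_le_one hn hsvd.left_mem
  refine ⟨toC (firstCols hm R) * toC Q, toC Q * toC (firstCols hn L)ᵀ, ?_, ?_, ?_, ?_⟩
  · simpa using norm_mul_le_of_le (norm_firstCols_le_one hm hsvd.right_mem) hQn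
  · simpa using norm_mul_le_of_le hQn hLn
  · rw [← hTc, ← hSc, ← toC_mul, hST]
    exact Matrix.map_one _ Complex.ofReal_zero Complex.ofReal_one
  · intro i
    rw [← hTc, ← hSc]
    have hPP : P * P⁻¹ = 1 := Matrix.mul_nonsing_inv _ hP
    have hPP' : P⁻¹ * P = 1 := Matrix.nonsing_inv_mul _ hP
    -- Markov parameters are invariant under the similarity `P`, so no bound on `P` or its inverse
    -- is needed and the choice of eigendecomposition is immaterial.
    have hpow : P * Ar ^ i = (toC S * toC A * toC T) ^ i * P := by
      induction i with
      | zero => simp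
      | succ i ih =>
        rw [pow_succ, ← Matrix.mul_assoc, ih, pow_succ, hAr, hΦ, hΨ, Matrix.mul_assoc]
        have : P * (P⁻¹ * toC S * toC A * (toC T * P)) = toC S * toC A * toC T * P := by
          simp only [← Matrix.mul_assoc, hPP, Matrix.one_mul]
        rw [this]
        simp only [Matrix.mul_assoc]
    calc Cr * Ar ^ i * Br = toC C * toC T * (P * Ar ^ i) * (P⁻¹ * toC S * toC B) := by
          rw [hCr, hBr, hΦ, hΨ]
          simp only [Matrix.mul_assoc]
      _ = toC C * toC T * (toC S * toC A * toC T) ^ i * ((P * P⁻¹) * toC S * toC B) := by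
          rw [hpow]
          simp only [Matrix.mul_assoc]
      _ = _ := by rw [hPP, Matrix.one_mul]

end ROM

/-- The deterministic part: the bounds hold for every noise realization for which the snapshots
excite all controllable and observable modes. -/
theorem exists_bounds_of_det_ne_zero {N p q l a b d m n : ℕ}
    {A : Matrix (Fin N) (Fin N) ℝ}
    {V U : Matrix (Fin N) (ModeIndex l a b d) ℂ} {Λ : ModeIndex l a b d → ℂ}
    (hA : IsStable A) (hmodal : IsModalDecomposition A V Λ U)
    {B : ℝ → Matrix (Fin N) (Fin p) ℝ} {C : ℝ → Matrix (Fin q) (Fin N) ℝ}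
    (hweak : IsWeaklyCoupled V U B C) (u : ℕ → Fin p → ℝ) (v : ℕ → Fin q → ℝ)
    (t : Fin m → ℕ) (s : Fin n → ℕ) (hm : l ≤ m) (hn : l ≤ n)
    (hX : ((modalSnapshots (fun j => Λ (Sum.inl j)) ((blockCO U)ᵀ * toC (B 0)) u t).submatrix id
      (Fin.castLE hm)).det ≠ 0)
    (hZ : ((modalSnapshots (fun j => Λ (Sum.inl j)) ((blockCO V)ᵀ * toC (C 0)ᵀ) v s).submatrix id
      (Fin.castLE hn)).det ≠ 0) :
    ∃ K ε₀ : ℝ, 0 < ε₀ ∧ ∀ ε : ℝ, |ε| < ε₀ →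
      (∀ i < l, 0 < singularValue (hankel A (B ε) (C ε) u v t s) i) ∧
      singularValue (hankel A (B ε) (C ε) u v t s) l ≤ K * |ε| ∧
      (∀ Ar Br Cr, IsROM hm hn A (B ε) (C ε) (primalSnapshots A (B ε) u t)
        (adjointSnapshots A (C ε) v s) Ar Br Cr → ∀ i : ℕ,
        ‖Cr * Ar ^ i * Br - toC (C ε * A ^ i * B ε)‖ ≤ K * |ε|) ∧
      (FirstOrderNonzero (fun η => hankel A (B η) (C η) u v t s) →
        |ε| ≤ K * singularValue (hankel A (B ε) (C ε) u v t s) l ∧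
        ∀ Ar Br Cr, IsROM hm hn A (B ε) (C ε) (primalSnapshots A (B ε) u t)
          (adjointSnapshots A (C ε) v s) Ar Br Cr → ∀ i : ℕ,
          ‖Cr * Ar ^ i * Br - toC (C ε * A ^ i * B ε)‖
            ≤ K * singularValue (hankel A (B ε) (C ε) u v t s) l) := by
  have hXw := hweak.isWeakInput_primalSnapshots hmodal u t
  have hZw := hweak.isWeakOutput_adjointSnapshots hmodal v s
  obtain ⟨⟨E₁, E₂, hquad⟩, hfac⟩ := hmodal.exists_mul_eq_quadratic hXw hZw
  have hXeq := hmodal.transpose_submatrix_mul_snapshots (Sum.inl : Fin l → _) (B 0) u t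
  have hZeq := hmodal.toC_transpose_adjointSnapshots_mul (Sum.inl : Fin l → _) (C 0) v s
  have hrank : (hankel A (B 0) (C 0) u v t s).rank = l := by
    refine rank_eq_of_factorization hfac hm hn ?_ ?_
    · rw [blockCO, hZeq, ← Matrix.det_transpose, Matrix.transpose_mul]
      exact hZ
    · have : (blockCO U)ᵀ * toC (primalSnapshots A (B 0) u t) = _ := hXeq
      rw [this]
      exact hX
  obtain ⟨c, K₁, ε₁, hc, hK₁, hε₁, hσ⟩ := exists_singularValue_bounds
    (H := fun η => hankel A (B η) (C η) u v t s) hquad hrank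
  obtain ⟨β₁, hβ₁, hB⟩ := hweak.isWeakInput.exists_bound
  obtain ⟨β₂, hβ₂, hC⟩ := hweak.isWeakOutput.exists_bound
  obtain ⟨β₃, hβ₃, hXb⟩ := hXw.exists_bound
  obtain ⟨β₄, hβ₄, hZb⟩ := hZw.exists_bound
  -- A bound for `Σ_r^{-1/2}` uniform in `ε`: it transfers the modal bounds of `X` and `Z` to the
  -- projections `T` and `S`.
  set g := (√c)⁻¹ with hg
  have hg0 : 0 ≤ g := by positivity
  have p₃ : 0 ≤ β₃ * g := by positivity
  have p₄ : 0 ≤ g * β₄ := by positivity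
  set β := β₁ + β₂ + β₃ * g + g * β₄ with hβ
  obtain ⟨K₂, ε₂, hK₂, hε₂, herr⟩ := hmodal.exists_norm_markov_sub_le (κ := Fin q) (κ' := Fin p)
    (hmodal.norm_lt_one hA) (β := β) (by positivity)
  refine ⟨K₁ + K₂ + K₂ * K₁, min ε₁ ε₂, by positivity, fun ε hε => ?_⟩
  obtain ⟨hσ₁, hσ₂, hσ₃⟩ := hσ ε (hε.trans_le (min_le_left _ _))
  have herr' : ∀ Ar Br Cr, IsROM hm hn A (B ε) (C ε) (primalSnapshots A (B ε) u t)
      (adjointSnapshots A (C ε) v s) Ar Br Cr → ∀ i : ℕ,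
      ‖Cr * Ar ^ i * Br - toC (C ε * A ^ i * B ε)‖ ≤ K₂ * |ε| := by
    intro Ar Br Cr hrom i
    obtain ⟨M, M', hM, hM', hone, heq⟩ := hrom.exists_projection hc hσ₁
    have hpow : toC (A ^ i) = toC A ^ i := map_pow Complex.ofRealHom.mapMatrix A i
    rw [heq i, toC_mul, toC_mul, hpow]
    exact herr ε (hε.trans_le (min_le_right _ _)) _ _ _ _
      ((hC ε).mono (by linarith)) ((hB ε).mono (by linarith))
      (((hZb ε).mul hM').mono (by linarith)) (((hXb ε).mul hM).mono (by linarith)) hone i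
  have hε0 := abs_nonneg ε
  have hK₁₂ : 0 ≤ K₂ * K₁ := by positivity
  refine ⟨fun i hi => hc.trans_le (hσ₁ i hi), hσ₂.trans (by gcongr; linarith),
    fun Ar Br Cr hrom i => (herr' Ar Br Cr hrom i).trans (by gcongr; linarith), fun hF => ?_⟩
  have hσ0 : 0 ≤ singularValue (hankel A (B ε) (C ε) u v t s) l :=
    LinearMap.singularValues_nonneg _ _
  have h3 : |ε| ≤ K₁ * singularValue (hankel A (B ε) (C ε) u v t s) l := hσ₃ hF
  refine ⟨h3.trans (by gcongr; linarith), fun Ar Br Cr hrom i => ?_⟩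
  calc _ ≤ K₂ * |ε| := herr' Ar Br Cr hrom i
    _ ≤ K₂ * (K₁ * singularValue (hankel A (B ε) (C ε) u v t s) l) := by gcongr
    _ ≤ _ := by
      rw [← mul_assoc]
      gcongr
      linarith

end RPOD

theorem corollary2 {N p q l a b d m n : ℕ}
    -- the system: `A` is stable and diagonalizable, its modes are in four groups
    (A : Matrix (Fin N) (Fin N) ℝ)
    (V U : Matrix (Fin N) (RPOD.ModeIndex l a b d) ℂ) (Λ : RPOD.ModeIndex l a b d → ℂ)
    (hA : RPOD.IsStable A) (hmodal : RPOD.IsModalDecomposition A V Λ U)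
    -- weak coupling of strength `ε` to the uncontrollable and to the unobservable modes
    (B : ℝ → Matrix (Fin N) (Fin p) ℝ) (C : ℝ → Matrix (Fin q) (Fin N) ℝ)
    (hweak : RPOD.IsWeaklyCoupled V U B C)
    -- the first `l` modes are controllable and observable
    (hctrl : RPOD.AllControllable A (RPOD.blockCO U) (B 0))
    (hobs : RPOD.AllObservable A (RPOD.blockCO V) (C 0))
    -- white noise inputs of the primal and the adjoint system, and the snapshot times
    {Ω : Type*} [MeasurableSpace Ω] (P : MeasureTheory.Measure Ω)
    [MeasureTheory.IsProbabilityMeasure P]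
    (u : ℕ → Ω → Fin p → ℝ) (v : ℕ → Ω → Fin q → ℝ)
    (hu : RPOD.IsWhiteNoise P u) (hv : RPOD.IsWhiteNoise P v)
    (t : Fin m → ℕ) (s : Fin n → ℕ) (ht : StrictMono t) (hs : StrictMono s)
    (ht_pos : ∀ k, 1 ≤ t k) (hs_pos : ∀ k, 1 ≤ s k) (hm : l ≤ m) (hn : l ≤ n) :
    ∀ᵐ ω ∂P, ∃ K ε₀ : ℝ, 0 < ε₀ ∧ ∀ ε : ℝ, |ε| < ε₀ →
      let X := RPOD.primalSnapshots A (B ε) (fun k => u k ω) t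
      let Z := RPOD.adjointSnapshots A (C ε) (fun k => v k ω) s
      let H := fun η : ℝ => RPOD.hankel A (B η) (C η) (fun k => u k ω) (fun k => v k ω) t s
      -- the first `l` singular values are positive, and the next one is `O(ε)`
      (∀ i, i < l → 0 < RPOD.singularValue (H ε) i) ∧
      RPOD.singularValue (H ε) l ≤ K * |ε| ∧
      -- the Markov parameter error is `O(ε)`
      (∀ Ar Br Cr, RPOD.IsROM hm hn A (B ε) (C ε) X Z Ar Br Cr → ∀ i : ℕ, 1 ≤ i →
        ‖Cr * Ar ^ i * Br - RPOD.toC (C ε * A ^ i * B ε)‖ ≤ K * |ε|) ∧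
      -- unless `σ_{l+1}` vanishes to first order, `ε` and the error are `O(σ_{l+1})`
      (RPOD.FirstOrderNonzero H →
        |ε| ≤ K * RPOD.singularValue (H ε) l ∧
        ∀ Ar Br Cr, RPOD.IsROM hm hn A (B ε) (C ε) X Z Ar Br Cr → ∀ i : ℕ, 1 ≤ i →
          ‖Cr * Ar ^ i * Br - RPOD.toC (C ε * A ^ i * B ε)‖
            ≤ K * RPOD.singularValue (H ε) l) := by
  -- Two null sets, one per noise, are discarded. They are defined at `ε = 0`, so the exceptional
  -- set does not depend on `ε`.
  filter_upwards [(hctrl.isPBH hmodal).ae_det_ne_zero hu ht ht_pos hm,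
    (hobs.allControllable_transpose.isPBH hmodal.transpose).ae_det_ne_zero hv hs hs_pos hn]
    with ω hX hZ
  obtain ⟨K, ε₀, hε₀, h⟩ := RPOD.exists_bounds_of_det_ne_zero hA hmodal hweak (fun k => u k ω)
    (fun k => v k ω) t s hm hn hX hZ
  refine ⟨K, ε₀, hε₀, fun ε hε => ?_⟩
  obtain ⟨h1, h2, h3, h4⟩ := h ε hε
  exact ⟨h1, h2, fun Ar Br Cr hrom i _ => h3 Ar Br Cr hrom i,
    fun hF => ⟨(h4 hF).1, fun Ar Br Cr hrom i _ => (h4 hF).2 Ar Br Cr hrom i⟩⟩
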